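/- Conventions. Let $k:\mathbb{R}^d\to\mathbb{R}$ be continuous and such that $\int (1+\|z\|)^{-n}|k(z)|\,dz<\infty$ for some $n$; consider the stationary kernel $k(x,x')=k(x-x')$. A function $\kappa$ on $\mathbb{R}^d$ is called positive definite if the stationary kernel $\kappa(x-x')$ is Hermitian and $\sum_{i,j}\overline{c_i}\,\kappa(x_i-x_j)\,c_j\ge 0$ for all finite families of points $x_i$ and scalars $c_i$; equivalently, $\kappa(x-x')$ is the reproducing kernel of a reproducing kernel Hilbert space (RKHS). The kernel $k$ *admits a positive decomposition* if $k=k_+-k_-$ with two stationary positive definite kernels $k_\pm(x-x')$, $k_\pm:\mathbb{R}^d\to\mathbb{R}$ (no continuity of $k_\pm$ is required). The generalized Fourier transform is that of tempered distributions, with the normalization $\widehat f(\omega)=\int f(x)e^{-2\pi \mathrm{i}\,\omega^\top x}\,dx$. A signed Radon measure $\mu$ on $\mathbb{R}^d$ is given by its Jordan decomposition, a pair of mutually singular, locally finite nonnegative Borel measures $\mu^+,\mu^-$ (both may have infinite mass); that it is the generalized Fourier transform of $k$ means $\int k\,\widehat\varphi\,dz=\int\varphi\,d\mu^+-\int\varphi\,d\mu^-$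 for all smooth compactly supported $\varphi$. Its total mass is $\|\mu\|=\mu^+(\mathbb{R}^d)+\mu^-(\mathbb{R}^d)\in[0,\infty]$. Theorem. (i) (Existence) The kernel $k$ admits a positive decomposition if and only if its generalized Fourier transform is a signed Radon measure of finite total mass. In particular, if the generalized Fourier transform of $k$ is the signed Radon measure $\mu$, then $k$ admits a positive decomposition if and only if $\|\mu\|<\infty$. (ii) (Representation) Let the generalized Fourier transform of $k$ be a signed Radon measure $\mu$ with $\|\mu\|<\infty$, and let $\mu=\mu_+-\mu_-$ with any finite nonnegative Borel measures $\mu_\pm$. Put $k_\pm(z)=\int e^{2\pi \mathrm{i}\,\omega^\top z}\,d\mu_\pm(\omega)$. Then $k_+$ and $k_-$ are (in general complex-valued) positive definite functions, $k=k_+-k_-$, and the RKHS $\mathcal H_\pm$ of complex-valued functions (or of real-valued functions, if $k_\pm$ is real-valued) with reproducing kernel $k_\pm(x-x')$ is $$\mathcal H_\pm=\Big\{f \text{ continuous}:\ \|f\|_{\mathcal H_\pm}^2=\int_{\mathbb{R}^d}\frac{|F(\omega)|^2}{\mu_\pm(\omega)}\,d\omega<\infty\Big\},$$ where $F$ is the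 generalized Fourier transform of $f$. In this formula the functions $f$ satisfy $\int(1+\|x\|)^{-n}|f(x)|\,dx<\infty$ for some $n$, $d\omega$ may be any locally finite Borel measure $m$ with respect to which $\mu_\pm$ has a density $\mu_\pm(\omega)$ (Lebesgue measure if $\mu_\pm$ is absolutely continuous; $m=\mu_\pm$ is always possible), $F$ is the density of the Fourier transform of $f$ with respect to $m$ (a locally $m$-integrable function, required to exist), and the integrand is $0$ where $F=\mu_\pm=0$ and $\infty$ where $F\neq0=\mu_\pm$. -/

import Mathlib

open MeasureTheory
open scoped FourierTransform SchwartzMap ENNReal ComplexOrder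

noncomputable section

namespace StationaryKernel

variable {E : Type*} [NormedAddCommGroup E] [InnerProductSpace ℝ E] [FiniteDimensional ℝ E]
  [MeasurableSpace E] [BorelSpace E]

/-- The stationary kernel `(x, y) ↦ κ (x - y)` is positive definite: it is Hermitian and
`∑ conj (c x) * κ (x - y) * c y ≥ 0` for all finitely supported coefficients `c`. -/
def IsPositiveDefinite {𝕜 : Type*} [RCLike 𝕜] (κ : E → 𝕜) : Prop :=
  (Matrix.of fun x y : E => κ (x - y)).PosSemidef

/-- The stationary kernel `k (x - y)` is the difference of two stationary positive definite
kernels. Nothing else (for example continuity) is required of the two kernels. -/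
def HasPositiveDecomposition (k : E → ℝ) : Prop :=
  ∃ kp km : E → ℝ, IsPositiveDefinite kp ∧ IsPositiveDefinite km ∧ ∀ z, k z = kp z - km z

/-- `f` is a function that defines a tempered distribution by integration:
it is integrable against some power of `1 + ‖z‖`. -/
def IsTempered (f : E → ℂ) : Prop :=
  ∃ n : ℕ, Integrable (fun z => (1 + ‖z‖) ^ (-(n : ℝ)) • f z)

/-- The generalized Fourier transform of `f`, that is, the Fourier transform
`φ ↦ ∫ f z * (𝓕 φ) z` of `f` as a tempered distribution, is given by the functional `T` on the
(dense) space of smooth functions with compact support.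
Here `𝓕 φ z = ∫ exp (-2 π i ⟪x, z⟫) φ x`. -/
def HasGeneralizedFourier (f : E → ℂ) (T : 𝓢(E, ℂ) → ℂ) : Prop :=
  IsTempered f ∧ ∀ φ : 𝓢(E, ℂ), HasCompactSupport φ → ∫ z, f z * (𝓕 φ) z = T φ

/-- A signed Radon measure, of finite or infinite total mass, given by its Jordan decomposition:
two mutually singular locally finite nonnegative Borel measures. Its value on a bounded Borel
set is the difference of the values of the two parts; both parts may have infinite mass. -/
structure SignedRadonMeasure (E : Type*) [TopologicalSpace E] [MeasurableSpace E] where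
  /-- The positive part. -/
  pos : Measure E
  /-- The negative part. -/
  neg : Measure E
  pos_locallyFinite : IsLocallyFiniteMeasure pos
  neg_locallyFinite : IsLocallyFiniteMeasure neg
  mutuallySingular : pos ⟂ₘ neg

/-- The total mass `‖μ‖ = ‖μ₊‖ + ‖μ₋‖`. -/
def SignedRadonMeasure.totalMass (μ : SignedRadonMeasure E) : ℝ≥0∞ :=
  μ.pos Set.univ + μ.neg Set.univ

/-- `μ = μp - μm`, written without subtraction; used for finite measures `μp` and `μm`. -/
def SignedRadonMeasure.IsSplit (μ : SignedRadonMeasure E) (μp μm : Measure E) : Prop :=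
  μ.pos + μm = μ.neg + μp

/-- The generalized Fourier transform of the real function `k` is the signed measure `μ`. -/
def HasFourierMeasure (k : E → ℝ) (μ : SignedRadonMeasure E) : Prop :=
  HasGeneralizedFourier (fun z => (k z : ℂ)) fun φ => ∫ ω, φ ω ∂μ.pos - ∫ ω, φ ω ∂μ.neg

/-- The generalized Fourier transform of `f` is the function `F` with respect to the reference
measure `m`, that is, the (complex) measure `F m`. For Lebesgue measure `m = volume` this says
that the generalized Fourier transform of `f` is the function `F`. -/
def HasFourierDensity (f : E → ℂ) (m : Measure E) (F : E → ℂ) : Prop :=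
  LocallyIntegrable F m ∧ HasGeneralizedFourier f fun φ => ∫ ω, φ ω * F ω ∂m

/-- The function `z ↦ ∫ exp (2 π i ⟪ω, z⟫) dν(ω)` with Fourier transform `ν`. -/
def kernelOf (ν : Measure E) (z : E) : ℂ :=
  ∫ ω, Complex.exp (2 * Real.pi * Complex.I * (inner ℝ ω z : ℝ)) ∂ν

/-- `∫ |F(ω)|² / ν(ω) dω`, where `F` and `p` are the densities of the Fourier transform and of `ν`
with respect to the reference measure `m`. By the conventions of `ℝ≥0∞`, the integrand is `0`
where `F = p = 0`, and `∞` where `F ≠ 0 = p`. -/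
def spectralEnergy (m : Measure E) (p : E → ℝ≥0∞) (F : E → ℂ) : ℝ≥0∞ :=
  ∫⁻ ω, ‖F ω‖ₑ ^ 2 / p ω ∂m

/-- The space `H` of `𝕜`-valued functions on `E` (`𝕜 = ℝ` or `ℂ`) is
`{f continuous | ‖f‖² = ∫ |F(ω)|² / ν(ω) dω < ∞}`, `F` being the Fourier transform of `f`.
The quotient is formed with the densities with respect to any reference measure `m` for which
`ν` has a density `p`. With `m = volume` this is the formula for a measure `ν` with a Lebesgue
density; `m = ν`, `p = 1` is a possible choice for every `ν`. -/
def IsSpectralSpace {𝕜 : Type*} [RCLike 𝕜] (H : Type*) [NormedAddCommGroup H]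
    [InnerProductSpace 𝕜 H] [RKHS 𝕜 H E 𝕜] (ν : Measure E) : Prop :=
  ∀ (m : Measure E) (p : E → ℝ≥0∞), IsLocallyFiniteMeasure m → Measurable p →
    ν = m.withDensity p →
    (∀ f : E → 𝕜, (∃ h : H, ⇑h = f) ↔
      Continuous f ∧ ∃ F : E → ℂ, HasFourierDensity (fun x => RCLike.map 𝕜 ℂ (f x)) m F ∧
        spectralEnergy m p F < ∞) ∧
    ∀ (h : H) (F : E → ℂ), HasFourierDensity (fun x => RCLike.map 𝕜 ℂ (h x)) m F →
      ENNReal.ofReal (‖h‖ ^ 2) = spectralEnergy m p F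

end StationaryKernel

end

-- The difficulty in (i) is that the two kernels with k = kp - km may be discontinuous, so that
-- Bochner's theorem does not apply to them. Let V be the Hilbert space of the kernel kp + km,
-- generated by vectors v_x. Each function k(· - y) equals ⟪v_·, g_y⟫ for some g_y in V.
-- Translations act on V by isometries, so ‖g_y‖ does not depend on y, and y ↦ g_y is weakly
-- continuous because k is continuous; together this gives norm continuity (`continuous_of_weak`).
-- The projections e_x of v_x to the closed span of the g_y satisfy ⟪e_x, g_y⟫ = k(x - y), and they
-- are continuous for the same reason. Polarizing this pairing writes k as the difference of the
-- Gram functions of (e + g)/2 and (e - g)/2, both stationary and continuous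
-- (`HasPositiveDecomposition.exists_continuous_gram`).
--
-- Bochner's theorem (`exists_kernelOf_eq_of_gram`) then gives finite measures: a Gaussian factor
-- makes the function integrable with nonnegative Fourier transform, Fourier inversion applies, and
-- the factor is removed by tightness. Conversely, real parts of Fourier transforms of finite
-- measures are positive definite. Smooth functions with compact support determine locally finite
-- measures (`measure_ext_of_integral_contDiff`) and, through 𝓕, continuous tempered functions
-- (`eq_of_hasGeneralizedFourier`). Hence a signed measure that is the transform of k is the
-- difference of the finite measures found, and mutual singularity of its parts bounds its mass.
--
-- For (ii), the kernel of ν is the Gram matrix of the characters in L²(ν). The RKHS is therefore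
-- isometric to the closed 𝕜-span of the characters, and its elements are the 𝕜-valued transforms of
-- G ν with G in L²(ν). If ν = p m, then F = G p and |F|² / p = |G|² p, so the spectral energy is
-- the L²(ν) norm squared.

universe u

noncomputable section

open Filter Topology
open scoped RealInnerProductSpace ContDiff

namespace StationaryKernel

set_option linter.unusedSectionVars false

variable {E : Type*} [NormedAddCommGroup E] [InnerProductSpace ℝ E] [FiniteDimensional ℝ E]
  [MeasurableSpace E] [BorelSpace E]

/-! ### Tempered functions and Schwartz decay -/

section Tempered

theorem exists_one_add_norm_pow_mul_le (ψ : 𝓢(E, ℂ)) (n : ℕ) :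
    ∃ C : ℝ, 0 ≤ C ∧ ∀ x, (1 + ‖x‖) ^ n * ‖ψ x‖ ≤ C := by
  have h := fun x => SchwartzMap.one_add_le_sup_seminorm_apply (𝕜 := ℝ) (m := (n, 0))
    (le_refl n) (le_refl 0) ψ x
  simp only [norm_iteratedFDeriv_zero] at h
  exact ⟨_, le_trans (by positivity) (h 0), h⟩

theorem IsTempered.aestronglyMeasurable {f : E → ℂ} (hf : IsTempered f) :
    AEStronglyMeasurable f volume := by
  obtain ⟨n, hn⟩ := hf
  have h : f = fun z => (1 + ‖z‖) ^ (n : ℝ) • ((1 + ‖z‖) ^ (-(n : ℝ)) • f z) := by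
    ext z
    have : (0 : ℝ) < 1 + ‖z‖ := by positivity
    rw [smul_smul, ← Real.rpow_add this]
    simp
  rw [h]
  have hc : Continuous fun z : E => (1 + ‖z‖) ^ (n : ℝ) := by
    simp only [Real.rpow_natCast]
    fun_prop
  exact hc.aestronglyMeasurable.smul hn.aestronglyMeasurable

theorem norm_rpow_neg_smul (z : E) (n : ℕ) (c : ℂ) :
    ‖(1 + ‖z‖) ^ (-(n : ℝ)) • c‖ = ((1 + ‖z‖) ^ n)⁻¹ * ‖c‖ := by
  have : (0 : ℝ) < 1 + ‖z‖ := by positivity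
  rw [norm_smul, Real.norm_of_nonneg (by positivity), Real.rpow_neg this.le, Real.rpow_natCast]

theorem IsTempered.integrable_mul {f : E → ℂ} (hf : IsTempered f) (ψ : 𝓢(E, ℂ)) :
    Integrable fun z => f z * ψ z := by
  have hm := hf.aestronglyMeasurable
  obtain ⟨n, hn⟩ := hf
  obtain ⟨C, -, hC⟩ := exists_one_add_norm_pow_mul_le ψ n
  refine (hn.norm.const_mul C).mono' (hm.mul ψ.continuous.aestronglyMeasurable) (.of_forall fun z => ?_)
  rw [norm_rpow_neg_smul, norm_mul]
  have h0 : (0 : ℝ) < (1 + ‖z‖) ^ n := by positivity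
  calc ‖f z‖ * ‖ψ z‖ = ((1 + ‖z‖) ^ n * ‖ψ z‖) * (((1 + ‖z‖) ^ n)⁻¹ * ‖f z‖) := by
        field_simp
    _ ≤ _ := by gcongr; exact hC z

theorem IsTempered.sub {f g : E → ℂ} (hf : IsTempered f) (hg : IsTempered g) :
    IsTempered fun z => f z - g z := by
  have mono : ∀ {f : E → ℂ} {n m : ℕ}, n ≤ m → AEStronglyMeasurable f volume →
      Integrable (fun z => (1 + ‖z‖) ^ (-(n : ℝ)) • f z) →
      Integrable (fun z => (1 + ‖z‖) ^ (-(m : ℝ)) • f z) := by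
    intro f n m hnm hfm hn
    have hc : Continuous fun z : E => (1 + ‖z‖) ^ (-(m : ℝ)) := by
      refine Continuous.rpow_const (by fun_prop) fun z => Or.inl ?_
      positivity
    refine hn.mono (hc.aestronglyMeasurable.smul hfm) (.of_forall fun z => ?_)
    · rw [norm_rpow_neg_smul, norm_rpow_neg_smul]
      gcongr
      linarith [norm_nonneg z]
  have h1 := hf.aestronglyMeasurable
  have h2 := hg.aestronglyMeasurable
  obtain ⟨n, hn⟩ := hf
  obtain ⟨m, hm⟩ := hg
  refine ⟨max n m, ?_⟩
  simp only [smul_sub]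
  exact (mono (le_max_left n m) h1 hn).sub (mono (le_max_right n m) h2 hm)

theorem isTempered_of_bounded {f : E → ℂ} (hf : Continuous f) {C : ℝ} (hC : ∀ z, ‖f z‖ ≤ C) :
    IsTempered f := by
  refine ⟨Module.finrank ℝ E + 1, ?_⟩
  refine ((integrable_one_add_norm (E := E) (μ := volume)
    (r := ((Module.finrank ℝ E + 1 : ℕ) : ℝ)) (by push_cast; linarith)).const_mul C).mono'
    (Continuous.aestronglyMeasurable ?_) (.of_forall fun z => ?_)
  · refine Continuous.smul (Continuous.rpow_const (by fun_prop) fun z => Or.inl ?_) hf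
    positivity
  · rw [norm_smul, Real.norm_of_nonneg (by positivity), mul_comm]
    gcongr
    exact hC z

end Tempered

/-! ### Uniqueness of generalized Fourier transforms -/

section Uniqueness

/-- Fubini, after `χ (ε • w)` has been written by inversion as an integral of characters against `𝓕
χ`. The right side is an average of translates of `𝓕 φ`, which tends to `𝓕 φ` as ε → 0 when `χ 0 =
1`. -/
theorem fourier_comp_smul_mul (χ φ : 𝓢(E, ℂ)) (ε : ℝ) (x : E) :
    𝓕 (fun w => χ (ε • w) * φ w) x = ∫ y, 𝓕 χ y * 𝓕 φ (x - ε • y) := by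
  have key := VectorFourier.integral_fourierIntegral_smul_eq_flip (e := Real.fourierChar)
    (μ := (volume : Measure E)) (ν := (volume : Measure E)) (L := (-ε) • innerₗ E)
    (f := ((𝓕 χ : 𝓢(E, ℂ)) : E → ℂ)) (g := fun w => Real.fourierChar (-⟪w, x⟫) • φ w)
    Real.continuous_fourierChar (by simp only [LinearMap.smul_apply, innerₗ_apply_apply]; fun_prop)
    ((𝓕 χ).integrable)
    ((Real.fourierIntegral_convergent_iff x).2 φ.integrable)
  have inv : ∀ w, VectorFourier.fourierIntegral Real.fourierChar volume ((-ε) • innerₗ E)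
      ((𝓕 χ : 𝓢(E, ℂ)) : E → ℂ) w = χ (ε • w) := by
    intro w
    have h : 𝓕⁻ (𝓕 χ) (ε • w) = χ (ε • w) := by simp
    rw [← h, SchwartzMap.fourierInv_coe, Real.fourierInv_eq, VectorFourier.fourierIntegral]
    congr 1 with y
    simp [inner_smul_right]
  simp only [inv] at key
  rw [Real.fourier_eq]
  trans ∫ w, χ (ε • w) • Real.fourierChar (-⟪w, x⟫) • φ w
  · congr 1 with w
    simp only [Circle.smul_def, smul_eq_mul]
    ring
  rw [key]
  congr 1 with y
  rw [smul_eq_mul, SchwartzMap.fourier_coe, SchwartzMap.fourier_coe, Real.fourier_eq φ,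
    VectorFourier.fourierIntegral]
  congr 2 with w
  simp only [LinearMap.flip_apply, LinearMap.smul_apply, innerₗ_apply_apply, smul_eq_mul,
    Circle.smul_def, ← mul_assoc, ← Circle.coe_mul, ← AddChar.map_add_eq_mul, inner_sub_right,
    inner_smul_right, real_inner_comm y w]
  congr 3
  ring

/-- Extends the test functions from compactly supported to all Schwartz functions: φ is cut off to
`χ (ε • ·) φ`, and ε → 0 under dominated convergence. -/
theorem integral_mul_fourier_eq_zero {g : E → ℂ} (hg : IsTempered g)
    (h : ∀ φ : 𝓢(E, ℂ), HasCompactSupport φ → ∫ z, g z * (𝓕 φ) z = 0) (φ : 𝓢(E, ℂ)) :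
    ∫ z, g z * (𝓕 φ) z = 0 := by
  obtain ⟨b⟩ : Nonempty (ContDiffBump (0 : E)) := inferInstance
  have hb1 : HasCompactSupport (fun x => ((b x : ℝ) : ℂ)) :=
    b.hasCompactSupport.comp_left (g := fun r : ℝ => (r : ℂ)) (by simp)
  have hb2 : ContDiff ℝ ∞ (fun x => ((b x : ℝ) : ℂ)) := Complex.ofRealCLM.contDiff.comp b.contDiff
  set χ : 𝓢(E, ℂ) := hb1.toSchwartzMap hb2 with hχ
  have hχ0 : χ 0 = 1 := by
    simp [hχ, b.one_of_mem_closedBall (Metric.mem_closedBall_self b.rIn_pos.le)]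
  have hX : ∫ y, 𝓕 χ y = 1 := by
    have h : 𝓕⁻ (𝓕 χ) (0 : E) = χ 0 := by simp
    rw [SchwartzMap.fourierInv_coe, Real.fourierInv_eq, hχ0] at h
    simpa using h
  set ε : ℕ → ℝ := fun j => 1 / ((j : ℝ) + 1) with hε
  have hε0 : ∀ j, 0 < ε j := fun j => by positivity
  have hε1 : ∀ j, ε j ≤ 1 := fun j => by
    rw [hε, div_le_one (by positivity)]; linarith [(Nat.cast_nonneg j : (0 : ℝ) ≤ j)]
  have hεt : Tendsto ε atTop (𝓝 0) := tendsto_one_div_add_atTop_nhds_zero_nat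
  -- the truncated test functions
  have c1 : ∀ j, HasCompactSupport (fun w => χ (ε j • w) * φ w) := fun j => by
    refine HasCompactSupport.mul_right ?_
    have : HasCompactSupport χ := hb1
    exact this.comp_homeomorph (Homeomorph.smulOfNeZero (ε j) (hε0 j).ne')
  have c2 : ∀ j, ContDiff ℝ ∞ (fun w => χ (ε j • w) * φ w) := fun j =>
    ((χ.smooth ⊤).comp (contDiff_const_smul (ε j))).mul (φ.smooth ⊤)
  have zero : ∀ j, ∫ x, g x * ∫ y, 𝓕 χ y * 𝓕 φ (x - ε j • y) = 0 := fun j => by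
    rw [← h ((c1 j).toSchwartzMap (c2 j)) (c1 j)]
    congr 1 with x
    rw [← fourier_comp_smul_mul, SchwartzMap.fourier_coe]
    rfl
  have hgm := hg.aestronglyMeasurable
  obtain ⟨n, hn⟩ := hg
  obtain ⟨C, hC0, hC⟩ := exists_one_add_norm_pow_mul_le (𝓕 φ) n
  obtain ⟨C', hC'0, hC'⟩ := exists_one_add_norm_pow_mul_le (𝓕 φ) 0
  have hC' : ∀ x, ‖𝓕 φ x‖ ≤ C' := by simpa using hC'
  have hXn : Integrable fun y => ‖𝓕 χ y‖ * (1 + ‖y‖) ^ n := by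
    obtain ⟨N, hN⟩ : ∃ N : ℕ, Integrable (fun y : E => (1 + ‖y‖) ^ (-(N : ℝ))) :=
      ⟨_, integrable_one_add_norm (E := E) (μ := volume)
        (r := ((Module.finrank ℝ E + 1 : ℕ) : ℝ)) (by push_cast; linarith)⟩
    obtain ⟨D, -, hD⟩ := exists_one_add_norm_pow_mul_le (𝓕 χ) (n + N)
    refine (hN.const_mul D).mono' (Continuous.aestronglyMeasurable
      ((𝓕 χ).continuous.norm.mul (by fun_prop))) (.of_forall fun y => ?_)
    have h0 : (0 : ℝ) < 1 + ‖y‖ := by positivity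
    rw [Real.norm_of_nonneg (by positivity), Real.rpow_neg h0.le, Real.rpow_natCast,
      ← div_eq_mul_inv, le_div_iff₀ (by positivity)]
    calc _ = (1 + ‖y‖) ^ (n + N) * ‖𝓕 χ y‖ := by rw [pow_add]; ring
      _ ≤ D := hD y
  -- A bound uniform in `j`: since ε ≤ 1, the weight `1 + ‖x‖` is at most the product of the weights
  -- at `x - ε y` and at `y`. The factor in `y` is absorbed by the decay of `𝓕 χ`.
  have shift : ∀ j x y, ‖𝓕 φ (x - ε j • y)‖ ≤ C * ((1 + ‖x‖) ^ n)⁻¹ * (1 + ‖y‖) ^ n := by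
    intro j x y
    have hx : 1 + ‖x‖ ≤ (1 + ‖x - ε j • y‖) * (1 + ‖y‖) := by
      have h1 : ‖x‖ ≤ ‖x - ε j • y‖ + ‖ε j • y‖ := by
        simpa using norm_add_le (x - ε j • y) (ε j • y)
      have h2 : ‖ε j • y‖ ≤ ‖y‖ := by
        rw [norm_smul, Real.norm_of_nonneg (hε0 j).le]
        exact mul_le_of_le_one_left (norm_nonneg _) (hε1 j)
      nlinarith [norm_nonneg y, norm_nonneg (x - ε j • y)]
    have h0 : (0 : ℝ) < (1 + ‖x‖) ^ n := by positivity
    rw [mul_right_comm, ← div_eq_mul_inv, le_div_iff₀ h0]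
    calc _ ≤ ‖𝓕 φ (x - ε j • y)‖ * ((1 + ‖x - ε j • y‖) * (1 + ‖y‖)) ^ n := by gcongr
      _ = ((1 + ‖x - ε j • y‖) ^ n * ‖𝓕 φ (x - ε j • y)‖) * (1 + ‖y‖) ^ n := by
        rw [mul_pow]; ring
      _ ≤ _ := by gcongr; exact hC _
  have meas : ∀ j, Continuous fun x => ∫ y, 𝓕 χ y * 𝓕 φ (x - ε j • y) := by
    intro j
    refine continuous_of_dominated (bound := fun y => ‖𝓕 χ y‖ * C') (fun x => ?_)
      (fun x => .of_forall fun y => ?_) ((𝓕 χ).integrable.norm.mul_const _)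
      (.of_forall fun y => ?_)
    · exact Continuous.aestronglyMeasurable ((𝓕 χ).continuous.mul
        ((𝓕 φ).continuous.comp (by fun_prop)))
    · rw [norm_mul]; gcongr; exact hC' _
    · exact continuous_const.mul ((𝓕 φ).continuous.comp (by fun_prop))
  have lim : ∀ x, Tendsto (fun j => ∫ y, 𝓕 χ y * 𝓕 φ (x - ε j • y)) atTop (𝓝 (𝓕 φ x)) := by
    intro x
    have e : 𝓕 φ x = ∫ y, 𝓕 χ y * 𝓕 φ x := by
      rw [integral_mul_const, hX, one_mul]
    rw [e]
    refine tendsto_integral_of_dominated_convergence (fun y => ‖𝓕 χ y‖ * C') (fun j => ?_)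
      ((𝓕 χ).integrable.norm.mul_const _) (fun j => .of_forall fun y => ?_)
      (.of_forall fun y => ?_)
    · exact Continuous.aestronglyMeasurable ((𝓕 χ).continuous.mul
        ((𝓕 φ).continuous.comp (by fun_prop)))
    · rw [norm_mul]; gcongr; exact hC' _
    · refine Tendsto.const_mul _ (((𝓕 φ).continuous.tendsto x).comp ?_)
      simpa using tendsto_const_nhds.sub (hεt.smul_const y)
  have final : Tendsto (fun j => ∫ x, g x * ∫ y, 𝓕 χ y * 𝓕 φ (x - ε j • y)) atTop
      (𝓝 (∫ x, g x * 𝓕 φ x)) := by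
    refine tendsto_integral_of_dominated_convergence
      (fun x => ‖(1 + ‖x‖) ^ (-(n : ℝ)) • g x‖ * (C * ∫ y, ‖𝓕 χ y‖ * (1 + ‖y‖) ^ n))
      (fun j => hgm.mul (meas j).aestronglyMeasurable) (hn.norm.mul_const _)
      (fun j => .of_forall fun x => ?_) (.of_forall fun x => (lim x).const_mul _)
    rw [norm_mul, norm_rpow_neg_smul]
    have : ‖∫ y, 𝓕 χ y * 𝓕 φ (x - ε j • y)‖ ≤
        C * ((1 + ‖x‖) ^ n)⁻¹ * ∫ y, ‖𝓕 χ y‖ * (1 + ‖y‖) ^ n := by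
      rw [← integral_const_mul]
      refine norm_integral_le_of_norm_le (hXn.const_mul _) (.of_forall fun y => ?_)
      rw [norm_mul]
      calc _ ≤ ‖𝓕 χ y‖ * (C * ((1 + ‖x‖) ^ n)⁻¹ * (1 + ‖y‖) ^ n) := by
            gcongr; exact shift j x y
        _ = _ := by ring
    calc _ ≤ ‖g x‖ * (C * ((1 + ‖x‖) ^ n)⁻¹ * ∫ y, ‖𝓕 χ y‖ * (1 + ‖y‖) ^ n) := by gcongr
      _ = _ := by ring
  simp only [zero] at final
  exact (tendsto_nhds_unique final tendsto_const_nhds)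

/-- A tempered continuous function is determined by its generalized Fourier transform. -/
theorem eq_of_hasGeneralizedFourier {f g : E → ℂ} (hf : Continuous f) (hg : Continuous g)
    {T : 𝓢(E, ℂ) → ℂ} (hfT : HasGeneralizedFourier f T) (hgT : HasGeneralizedFourier g T) :
    f = g := by
  have hsub := hfT.1.sub hgT.1
  have zero : ∀ φ : 𝓢(E, ℂ), ∫ z, (f z - g z) * (𝓕 φ) z = 0 := by
    refine integral_mul_fourier_eq_zero hsub fun φ hφ => ?_
    simp only [sub_mul]
    rw [integral_sub (hfT.1.integrable_mul _) (hgT.1.integrable_mul _), hfT.2 φ hφ, hgT.2 φ hφ,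
      sub_self]
  have hae : ∀ᵐ x ∂(volume : Measure E), f x - g x = 0 := by
    refine ae_eq_zero_of_integral_contDiff_smul_eq_zero
      ((hf.sub hg).locallyIntegrable) fun u hu hus => ?_
    have h1 : HasCompactSupport (fun x => ((u x : ℝ) : ℂ)) :=
      hus.comp_left (g := fun r : ℝ => (r : ℂ)) (by simp)
    have h2 : ContDiff ℝ ∞ (fun x => ((u x : ℝ) : ℂ)) := Complex.ofRealCLM.contDiff.comp hu
    -- Since 𝓕 is onto the Schwartz space, every smooth compactly supported function is some `𝓕 φ`.
    have := zero (𝓕⁻ (h1.toSchwartzMap h2))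
    rw [FourierTransform.fourier_fourierInv_eq] at this
    rw [← this]
    congr 1 with x
    simp [mul_comm]
  have hae' : f =ᵐ[volume] g := hae.mono fun x hx => sub_eq_zero.1 hx
  exact (Continuous.ae_eq_iff_eq volume hf hg).1 hae'

/-- The density of a Fourier transform with respect to a given measure is unique. -/
theorem HasFourierDensity.ae_eq {f : E → ℂ} {m : Measure E} {F G : E → ℂ}
    (hF : HasFourierDensity f m F) (hG : HasFourierDensity f m G) : F =ᵐ[m] G := by
  refine ae_eq_of_integral_contDiff_smul_eq hF.1 hG.1 fun u hu hus => ?_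
  have h1 : HasCompactSupport (fun x => ((u x : ℝ) : ℂ)) :=
    hus.comp_left (g := fun r : ℝ => (r : ℂ)) (by simp)
  have h2 : ContDiff ℝ ∞ (fun x => ((u x : ℝ) : ℂ)) := Complex.ofRealCLM.contDiff.comp hu
  have := (hF.2.2 (h1.toSchwartzMap h2) h1).symm.trans (hG.2.2 (h1.toSchwartzMap h2) h1)
  simpa using this

end Uniqueness

/-! ### Fourier transforms of measures with integrable density -/

section Transform

/-- The Fourier transform `z ↦ ∫ exp (2 π i ⟪w, z⟫) G(w) dν(w)` of the measure `G ν`. -/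
def charTransform (ν : Measure E) (G : E → ℂ) (z : E) : ℂ :=
  VectorFourier.fourierIntegral Real.fourierChar ν (-innerₗ E) G z

theorem charTransform_eq (ν : Measure E) (G : E → ℂ) (z : E) :
    charTransform ν G z = ∫ w, Real.fourierChar ⟪w, z⟫ • G w ∂ν := by
  simp [charTransform, VectorFourier.fourierIntegral]

theorem kernelOf_eq (ν : Measure E) (z : E) :
    kernelOf ν z = ∫ w, (Real.fourierChar ⟪w, z⟫ : ℂ) ∂ν := by
  rw [kernelOf]
  congr 1 with w
  rw [Real.fourierChar_apply]
  congr 1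
  push_cast
  ring

theorem kernelOf_eq_charTransform (ν : Measure E) : kernelOf ν = charTransform ν fun _ => 1 := by
  ext z
  rw [kernelOf_eq, charTransform_eq]
  simp [Circle.smul_def]

variable {ν : Measure E} {G : E → ℂ}

theorem continuous_charTransform (hG : Integrable G ν) : Continuous (charTransform ν G) :=
  VectorFourier.fourierIntegral_continuous Real.continuous_fourierChar
    (by simp only [LinearMap.neg_apply, innerₗ_apply_apply]; fun_prop) hG

theorem norm_charTransform_le (z : E) : ‖charTransform ν G z‖ ≤ ∫ w, ‖G w‖ ∂ν :=
  VectorFourier.norm_fourierIntegral_le_integral_norm _ _ _ _ _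

/-- Fubini moves the transform from `G ν` to `𝓕 φ`, where Fourier inversion returns φ. -/
theorem hasGeneralizedFourier_charTransform [SigmaFinite ν] (hG : Integrable G ν) :
    HasGeneralizedFourier (charTransform ν G) fun φ => ∫ w, φ w * G w ∂ν := by
  refine ⟨isTempered_of_bounded (continuous_charTransform hG) norm_charTransform_le,
    fun φ _ => ?_⟩
  have key := VectorFourier.integral_bilin_fourierIntegral_eq_flip (e := Real.fourierChar)
    (μ := ν) (ν := (volume : Measure E)) (L := -innerₗ E)
    (f := G) (g := ((𝓕 φ : 𝓢(E, ℂ)) : E → ℂ)) (ContinuousLinearMap.mul ℂ ℂ) Real.continuous_fourierChar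
    (by simp only [LinearMap.neg_apply, innerₗ_apply_apply]; fun_prop) hG ((𝓕 φ).integrable)
  simp only [ContinuousLinearMap.mul_apply'] at key
  refine key.trans ?_
  congr 1 with w
  have h : 𝓕⁻ (𝓕 φ) w = φ w := by simp
  rw [mul_comm, ← h, SchwartzMap.fourierInv_coe, Real.fourierInv_eq, VectorFourier.fourierIntegral]
  congr 2 with y
  simp [real_inner_comm]

theorem continuous_kernelOf (ν : Measure E) [IsFiniteMeasure ν] : Continuous (kernelOf ν) := by
  rw [kernelOf_eq_charTransform]
  exact continuous_charTransform (integrable_const _)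

theorem hasGeneralizedFourier_kernelOf (ν : Measure E) [IsFiniteMeasure ν] :
    HasGeneralizedFourier (kernelOf ν) fun φ => ∫ w, φ w ∂ν := by
  rw [kernelOf_eq_charTransform]
  simpa using hasGeneralizedFourier_charTransform (ν := ν) (G := fun _ => 1) (integrable_const _)

theorem locallyIntegrable_toReal_rnDeriv (γ m : Measure E) [IsLocallyFiniteMeasure γ]
    [IsLocallyFiniteMeasure m] : LocallyIntegrable (fun x => (γ.rnDeriv m x).toReal) m := by
  rw [locallyIntegrable_iff]
  intro K hK
  refine integrable_toReal_of_lintegral_ne_top (Measure.measurable_rnDeriv _ _).aemeasurable ?_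
  exact ((Measure.setLIntegral_rnDeriv_le K).trans_lt hK.measure_lt_top).ne

theorem isLocallyFiniteMeasure_add (α β : Measure E) [IsLocallyFiniteMeasure α]
    [IsLocallyFiniteMeasure β] : IsLocallyFiniteMeasure (α + β) := by
  refine ⟨fun x => ?_⟩
  obtain ⟨s, hs, hαs⟩ := α.finiteAt_nhds x
  obtain ⟨t, ht, hβt⟩ := β.finiteAt_nhds x
  refine ⟨s ∩ t, inter_mem hs ht, ?_⟩
  rw [Measure.add_apply]
  exact ENNReal.add_lt_top.2 ⟨(measure_mono Set.inter_subset_left).trans_lt hαs,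
    (measure_mono Set.inter_subset_right).trans_lt hβt⟩

/-- Locally finite measures that agree on smooth functions with compact support are equal. -/
theorem measure_ext_of_integral_contDiff {α β : Measure E} [IsLocallyFiniteMeasure α]
    [IsLocallyFiniteMeasure β] (h : ∀ u : E → ℝ, ContDiff ℝ ∞ u → HasCompactSupport u →
      ∫ x, u x ∂α = ∫ x, u x ∂β) : α = β := by
  -- Both measures have densities with respect to their sum, which reduces the claim to locally
  -- integrable functions.
  obtain ⟨m, hm, hα, hβ⟩ : ∃ m : Measure E, IsLocallyFiniteMeasure m ∧ α ≪ m ∧ β ≪ m :=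
    ⟨α + β, isLocallyFiniteMeasure_add α β, Measure.absolutelyContinuous_of_le (Measure.le_add_right le_rfl),
      Measure.absolutelyContinuous_of_le (Measure.le_add_left le_rfl)⟩
  have ae : ∀ᵐ x ∂m, (α.rnDeriv m x).toReal = (β.rnDeriv m x).toReal := by
    refine ae_eq_of_integral_contDiff_smul_eq (locallyIntegrable_toReal_rnDeriv α m)
      (locallyIntegrable_toReal_rnDeriv β m) fun u hu hus => ?_
    have e := h u hu hus
    rw [← integral_rnDeriv_smul hα, ← integral_rnDeriv_smul hβ] at e
    simpa only [smul_eq_mul, mul_comm] using e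
  rw [← Measure.withDensity_rnDeriv_eq α m hα, ← Measure.withDensity_rnDeriv_eq β m hβ]
  refine withDensity_congr_ae ?_
  filter_upwards [ae, Measure.rnDeriv_lt_top α m, Measure.rnDeriv_lt_top β m] with x hx h1 h2
  exact (ENNReal.toReal_eq_toReal_iff' h1.ne h2.ne).1 hx

end Transform

end StationaryKernel

end

noncomputable section

open Filter Topology
open scoped RealInnerProductSpace

namespace StationaryKernel

set_option linter.unusedSectionVars false

/-! ### The embedding of the scalars into ℂ -/

section ScalarMap

variable {𝕜 : Type*} [RCLike 𝕜]

theorem map_mul_complex (a b : 𝕜) :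
    RCLike.map 𝕜 ℂ (a * b) = RCLike.map 𝕜 ℂ a * RCLike.map 𝕜 ℂ b := by
  apply Complex.ext <;> simp [RCLike.map_apply, RCLike.mul_re, RCLike.mul_im]

theorem map_conj_complex (a : 𝕜) :
    RCLike.map 𝕜 ℂ (starRingEnd 𝕜 a) = starRingEnd ℂ (RCLike.map 𝕜 ℂ a) := by
  apply Complex.ext <;> simp [RCLike.map_apply]

theorem re_map_complex (a : 𝕜) : (RCLike.map 𝕜 ℂ a).re = RCLike.re a := by
  simp [RCLike.map_apply]

theorem im_map_complex (a : 𝕜) : (RCLike.map 𝕜 ℂ a).im = RCLike.im a := by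
  simp [RCLike.map_apply]

theorem norm_map_complex (a : 𝕜) : ‖RCLike.map 𝕜 ℂ a‖ = ‖a‖ := by
  rw [← sq_eq_sq₀ (norm_nonneg _) (norm_nonneg _), Complex.sq_norm, Complex.normSq_apply,
    re_map_complex, im_map_complex, RCLike.norm_sq_eq_def]

end ScalarMap

/-! ### Hilbert spaces generated by a family of vectors -/

section DenseFamily

variable {𝕜 : Type*} [RCLike 𝕜] {ι : Type*}
  {V : Type*} [NormedAddCommGroup V] [InnerProductSpace 𝕜 V]
  {W : Type*} [NormedAddCommGroup W] [InnerProductSpace 𝕜 W]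

theorem inner_linearCombination (v w : ι → V) (c c' : ι →₀ 𝕜) :
    inner 𝕜 (Finsupp.linearCombination 𝕜 v c) (Finsupp.linearCombination 𝕜 w c') =
      c.sum fun i a => c'.sum fun j b => starRingEnd 𝕜 a * inner 𝕜 (v i) (w j) * b := by
  simp only [Finsupp.linearCombination_apply, Finsupp.sum, sum_inner, inner_sum, inner_smul_left,
    inner_smul_right, Finset.mul_sum]
  rw [Finset.sum_comm]
  exact Finset.sum_congr rfl fun i _ => Finset.sum_congr rfl fun j _ => by ring

theorem norm_linearCombination_eq_of_gram {v : ι → V} {w : ι → W}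
    (h : ∀ i j, inner 𝕜 (v i) (v j) = inner 𝕜 (w i) (w j)) (c : ι →₀ 𝕜) :
    ‖Finsupp.linearCombination 𝕜 v c‖ = ‖Finsupp.linearCombination 𝕜 w c‖ := by
  rw [← sq_eq_sq₀ (norm_nonneg _) (norm_nonneg _), ← inner_self_eq_norm_sq (𝕜 := 𝕜),
    ← inner_self_eq_norm_sq (𝕜 := 𝕜), inner_linearCombination, inner_linearCombination]
  simp only [h]

/-- Families with the same Gram matrix are related by a linear isometry. -/
theorem exists_linearIsometry_of_gram [CompleteSpace W] {v : ι → V} {w : ι → W}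
    (hv : DenseRange (Finsupp.linearCombination 𝕜 v))
    (h : ∀ i j, inner 𝕜 (v i) (v j) = inner 𝕜 (w i) (w j)) :
    ∃ T : V →ₗᵢ[𝕜] W, ∀ i, T (v i) = w i := by
  have hn : ∀ c, ‖Finsupp.linearCombination 𝕜 w c‖ ≤ 1 * ‖Finsupp.linearCombination 𝕜 v c‖ :=
    fun c => by rw [one_mul, norm_linearCombination_eq_of_gram h]
  have he := LinearMap.extendOfNorm_eq hv ⟨1, hn⟩
  set T := (Finsupp.linearCombination 𝕜 w).extendOfNorm (Finsupp.linearCombination 𝕜 v) with hT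
  refine ⟨⟨T.toLinearMap, fun x => ?_⟩, fun i => ?_⟩
  · change ‖T x‖ = ‖x‖
    refine hv.induction_on (p := fun x => ‖T x‖ = ‖x‖) x
      (isClosed_eq (by fun_prop) (by fun_prop)) fun c => ?_
    rw [he, norm_linearCombination_eq_of_gram h]
  · have := he (Finsupp.single i 1)
    simpa using this

/-- The Riesz representation theorem, for a functional given on a family with dense span. -/
theorem exists_inner_eq_of_norm_le [CompleteSpace V] {v : ι → V}
    (hv : DenseRange (Finsupp.linearCombination 𝕜 v)) {f : ι → 𝕜} {C : ℝ}
    (h : ∀ c : ι →₀ 𝕜, ‖c.sum fun i a => a * starRingEnd 𝕜 (f i)‖ ≤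
      C * ‖Finsupp.linearCombination 𝕜 v c‖) :
    ∃ x : V, ∀ i, inner 𝕜 (v i) x = f i := by
  have hn : ∀ c, ‖Finsupp.linearCombination 𝕜 (fun i => starRingEnd 𝕜 (f i)) c‖ ≤
      C * ‖Finsupp.linearCombination 𝕜 v c‖ := by
    simpa only [Finsupp.linearCombination_apply, smul_eq_mul] using h
  have he := LinearMap.extendOfNorm_eq hv ⟨C, hn⟩
  set T := (Finsupp.linearCombination 𝕜 fun i => starRingEnd 𝕜 (f i)).extendOfNorm
    (Finsupp.linearCombination 𝕜 v) with hT
  refine ⟨(InnerProductSpace.toDual 𝕜 V).symm T, fun i => ?_⟩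
  rw [← inner_conj_symm, InnerProductSpace.toDual_symm_apply]
  have := he (Finsupp.single i 1)
  simp only [Finsupp.linearCombination_single, one_smul] at this
  rw [this, RingHomCompTriple.comp_apply]
  simp

theorem denseRange_linearCombination_iff {v : ι → V} :
    DenseRange (Finsupp.linearCombination 𝕜 v) ↔
      (Submodule.span 𝕜 (Set.range v)).topologicalClosure = ⊤ := by
  rw [← Submodule.dense_iff_topologicalClosure_eq_top, ← Finsupp.range_linearCombination]
  rfl

end DenseFamily

/-! ### Positive definite functions as Gram matrices -/

section Gram

variable {𝕜 : Type*} [RCLike 𝕜]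

theorem isPositiveDefinite_of_gram {E : Type*} [NormedAddCommGroup E] {V : Type*}
    [NormedAddCommGroup V] [InnerProductSpace 𝕜 V] {κ : E → 𝕜}
    (v : E → V) (h : ∀ x y, κ (x - y) = inner 𝕜 (v x) (v y)) : IsPositiveDefinite κ := by
  refine ⟨?_, fun c => ?_⟩
  · ext x y
    simp [h]
  · have := inner_linearCombination (𝕜 := 𝕜) v v c c
    simp only [Matrix.of_apply, h]
    rw [show (c.sum fun i a => c.sum fun j b => star a * inner 𝕜 (v i) (v j) * b) = _ from this.symm,
      RCLike.nonneg_iff]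
    exact ⟨inner_self_nonneg, inner_self_im _⟩

/-- A real positive definite function is the Gram matrix of a family with dense span. -/
theorem IsPositiveDefinite.exists_gram {E : Type u} [NormedAddCommGroup E] {κ : E → ℝ}
    (hκ : IsPositiveDefinite κ) :
    ∃ (V : Type u) (_ : NormedAddCommGroup V) (_ : InnerProductSpace ℝ V) (_ : CompleteSpace V)
      (v : E → V), (∀ x y, inner ℝ (v x) (v y) = κ (x - y)) ∧
      DenseRange (Finsupp.linearCombination ℝ v) := by
  -- `RKHS.OfKernel` takes operator-valued kernels, so scalars become multiples of the identity.
  let K : Matrix E E (ℝ →L[ℝ] ℝ) := Matrix.of fun x y => κ (x - y) • ContinuousLinearMap.id ℝ ℝ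
  have hsymm : ∀ x y, κ (x - y) = κ (y - x) := fun x y => by
    have := hκ.1.apply x y
    simpa using this.symm
  have hK : Fact K.PosSemidef := by
    have tfae := (RKHS.posSemidef_tfae (K := K)).out 0 2
    refine ⟨tfae.2 ⟨?_, fun c => ?_⟩⟩
    · ext x y
      have h1 : star (ContinuousLinearMap.id ℝ ℝ) = ContinuousLinearMap.id ℝ ℝ :=
        star_one (ℝ →L[ℝ] ℝ)
      simp [K, h1, hsymm x y]
    · have := hκ.2 c
      refine le_of_le_of_eq this ?_
      simp only [Finsupp.sum, K, Matrix.of_apply, RCLike.re_to_real]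
      refine Finset.sum_congr rfl fun i _ => Finset.sum_congr rfl fun j _ => ?_
      simp [hsymm j i]
      ring
  refine ⟨RKHS.OfKernel K, inferInstance, inferInstance, inferInstance,
    fun x => RKHS.kerFun (RKHS.OfKernel K) x (1 : ℝ), fun x y => ?_, ?_⟩
  · rw [RKHS.kerFun_inner, RKHS.kerFun_apply, RKHS.OfKernel.kernel_ofKernel]
    simp [K]
  · rw [denseRange_linearCombination_iff, eq_top_iff, ← RKHS.kerFun_dense (RKHS.OfKernel K)]
    refine Submodule.topologicalClosure_mono (Submodule.span_le.2 ?_)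
    rintro _ ⟨x, a, rfl⟩
    have : RKHS.kerFun (RKHS.OfKernel K) x a = a • RKHS.kerFun (RKHS.OfKernel K) x (1 : ℝ) := by
      rw [← map_smul, smul_eq_mul, mul_one]
    rw [this]
    exact Submodule.smul_mem _ _ (Submodule.subset_span ⟨x, rfl⟩)

end Gram

end StationaryKernel

end

noncomputable section

open Filter Topology
open scoped RealInnerProductSpace

namespace StationaryKernel

set_option linter.unusedSectionVars false

variable {E : Type*} [NormedAddCommGroup E] [InnerProductSpace ℝ E] [FiniteDimensional ℝ E]
  [MeasurableSpace E] [BorelSpace E]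

/-! ### Characters in L²(ν) and spaces with the same Gram matrix -/

section Characters

variable (ν : Measure E) [IsFiniteMeasure ν]

theorem continuous_char (x : E) : Continuous fun w : E => (Real.fourierChar (-⟪w, x⟫) : ℂ) :=
  continuous_induced_dom.comp (Real.continuous_fourierChar.comp (by fun_prop))

theorem memLp_char (x : E) : MemLp (fun w : E => (Real.fourierChar (-⟪w, x⟫) : ℂ)) 2 ν :=
  MemLp.of_bound (continuous_char x).aestronglyMeasurable 1 (.of_forall fun _ => (Circle.norm_coe _).le)

/-- The character `ω ↦ exp (-2 π i ⟪ω, x⟫)` as an element of `L²(ν)`. -/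
def charLp (x : E) : Lp ℂ 2 ν := (memLp_char ν x).toLp

variable {ν}

theorem inner_charLp_left (x : E) (G : Lp ℂ 2 ν) :
    inner ℂ (charLp ν x) G = charTransform ν G x := by
  rw [L2.inner_def, charTransform_eq]
  refine integral_congr_ae ?_
  filter_upwards [(memLp_char ν x).coeFn_toLp] with w hw
  rw [charLp, hw, RCLike.inner_apply, Circle.smul_def, smul_eq_mul, mul_comm,
    AddChar.map_neg_eq_inv, Circle.coe_inv_eq_conj, Complex.conj_conj]

theorem inner_charLp_charLp (x y : E) :
    inner ℂ (charLp ν x) (charLp ν y) = kernelOf ν (x - y) := by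
  rw [inner_charLp_left, charTransform_eq, kernelOf_eq]
  refine integral_congr_ae ?_
  filter_upwards [(memLp_char ν y).coeFn_toLp] with w hw
  rw [charLp, hw, Circle.smul_def, smul_eq_mul, ← Circle.coe_mul, ← AddChar.map_add_eq_mul,
    inner_sub_right, sub_eq_add_neg]

variable (ν) in
theorem isPositiveDefinite_kernelOf : IsPositiveDefinite (kernelOf ν) :=
  isPositiveDefinite_of_gram (charLp ν) fun x y => (inner_charLp_charLp x y).symm

variable {𝕜 : Type*} [RCLike 𝕜] {V : Type*} [NormedAddCommGroup V] [InnerProductSpace 𝕜 V]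
  {v : E → V}

variable (ν) in
/-- The trigonometric polynomial `∑ c x exp (-2 π i ⟪·, x⟫)` as an element of `L²(ν)`. -/
def trigLp (c : E →₀ 𝕜) : Lp ℂ 2 ν := c.sum fun x a => RCLike.map 𝕜 ℂ a • charLp ν x

theorem trigLp_sub (c c' : E →₀ 𝕜) : trigLp ν (c - c') = trigLp ν c - trigLp ν c' := by
  classical
  rw [trigLp, Finsupp.sum_sub_index fun x a b => by rw [map_sub, sub_smul]]
  rfl

theorem inner_trigLp_charLp (hv : ∀ x y, RCLike.map 𝕜 ℂ (inner 𝕜 (v x) (v y)) = kernelOf ν (x - y))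
    (x : E) (c : E →₀ 𝕜) : inner ℂ (charLp ν x) (trigLp ν c) =
      RCLike.map 𝕜 ℂ (inner 𝕜 (v x) (Finsupp.linearCombination 𝕜 v c)) := by
  simp only [trigLp, Finsupp.linearCombination_apply, Finsupp.sum, inner_sum, inner_smul_right,
    map_sum, map_mul_complex, hv, inner_charLp_charLp]

/-- Equal Gram matrices give equal norms. The scalars are 𝕜 on one side and ℂ on the other, so
`norm_linearCombination_eq_of_gram` does not cover this case. -/
theorem norm_trigLp (hv : ∀ x y, RCLike.map 𝕜 ℂ (inner 𝕜 (v x) (v y)) = kernelOf ν (x - y))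
    (c : E →₀ 𝕜) : ‖trigLp ν c‖ = ‖Finsupp.linearCombination 𝕜 v c‖ := by
  have h : inner ℂ (trigLp ν c) (trigLp ν c) = RCLike.map 𝕜 ℂ
      (inner 𝕜 (Finsupp.linearCombination 𝕜 v c) (Finsupp.linearCombination 𝕜 v c)) := by
    conv_lhs => enter [2]; rw [trigLp]
    conv_rhs => enter [2, 2]; rw [Finsupp.linearCombination_apply]
    simp only [Finsupp.sum, sum_inner, inner_smul_left, map_sum, map_mul_complex,
      map_conj_complex, inner_trigLp_charLp hv]
  rw [← sq_eq_sq₀ (norm_nonneg _) (norm_nonneg _), ← inner_self_eq_norm_sq (𝕜 := ℂ),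
    ← inner_self_eq_norm_sq (𝕜 := 𝕜), h, ← re_map_complex (inner 𝕜 _ _), RCLike.re_eq_complex_re]

/-- Every element of a Hilbert space with Gram matrix `kernelOf ν` is represented in `L²(ν)`. -/
theorem exists_Lp_of_gram (hd : DenseRange (Finsupp.linearCombination 𝕜 v))
    (hv : ∀ x y, RCLike.map 𝕜 ℂ (inner 𝕜 (v x) (v y)) = kernelOf ν (x - y)) (h : V) :
    ∃ G : Lp ℂ 2 ν, ‖G‖ = ‖h‖ ∧ ∀ x, charTransform ν G x = RCLike.map 𝕜 ℂ (inner 𝕜 (v x) h) := by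
  -- `V` is a space over 𝕜 and L²(ν) one over ℂ, so the isometry is followed along an approximating
  -- sequence.
  obtain ⟨u, hu, hlim⟩ := mem_closure_iff_seq_limit.1 (hd h)
  choose c hc using hu
  have hdist : ∀ n m, dist (trigLp ν (c n)) (trigLp ν (c m)) = dist (u n) (u m) := fun n m => by
    rw [dist_eq_norm, dist_eq_norm, ← trigLp_sub, norm_trigLp hv, map_sub, hc, hc]
  have hcau : CauchySeq fun n => trigLp ν (c n) := by
    have := hlim.cauchySeq
    rw [Metric.cauchySeq_iff] at this ⊢
    simpa only [hdist] using this
  obtain ⟨G, hG⟩ := cauchySeq_tendsto_of_complete hcau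
  refine ⟨G, ?_, fun x => ?_⟩
  · refine tendsto_nhds_unique hG.norm ?_
    simp only [norm_trigLp hv, hc]
    exact hlim.norm
  · rw [← inner_charLp_left]
    have h1 : Tendsto (fun n => inner ℂ (charLp ν x) (trigLp ν (c n))) atTop
        (𝓝 (inner ℂ (charLp ν x) G)) := tendsto_const_nhds.inner hG
    refine tendsto_nhds_unique h1 ?_
    simp only [inner_trigLp_charLp hv, hc]
    exact (((RCLike.map 𝕜 ℂ).continuous.comp
      (continuous_const.inner continuous_id)).tendsto h).comp hlim

/-- Conversely, every function on `E` represented in `L²(ν)` belongs to the Hilbert space. -/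
theorem exists_of_Lp_of_gram [CompleteSpace V] (hd : DenseRange (Finsupp.linearCombination 𝕜 v))
    (hv : ∀ x y, RCLike.map 𝕜 ℂ (inner 𝕜 (v x) (v y)) = kernelOf ν (x - y)) (G : Lp ℂ 2 ν)
    {f : E → 𝕜} (hf : ∀ x, charTransform ν G x = RCLike.map 𝕜 ℂ (f x)) :
    ∃ h : V, ∀ x, inner 𝕜 (v x) h = f x := by
  -- By Cauchy–Schwarz, pairing with `G` is a bounded functional on trigonometric polynomials; `G`
  -- need not lie in their closed span.
  refine exists_inner_eq_of_norm_le hd (C := ‖G‖) fun c => ?_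
  have h : RCLike.map 𝕜 ℂ (c.sum fun i a => a * starRingEnd 𝕜 (f i)) =
      inner ℂ G (trigLp ν c) := by
    simp only [trigLp, Finsupp.sum, inner_sum, inner_smul_right, map_sum, map_mul_complex,
      map_conj_complex, ← hf, ← inner_charLp_left, inner_conj_symm]
  rw [← norm_map_complex, h, ← norm_trigLp hv]
  exact norm_inner_le_norm _ _

end Characters

/-! ### Densities and the spectral energy -/

section Density

variable {ν m : Measure E} {p : E → ℝ≥0∞}

theorem ae_lt_top_of_withDensity [IsFiniteMeasure ν] (hp : Measurable p)
    (hν : ν = m.withDensity p) : ∀ᵐ w ∂m, p w < ∞ := by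
  refine ae_lt_top hp ?_
  rw [← setLIntegral_univ, ← withDensity_apply _ MeasurableSet.univ, ← hν]
  exact measure_ne_top ν _

theorem integral_mul_density [IsFiniteMeasure ν] (hp : Measurable p)
    (hν : ν = m.withDensity p) (φ G : E → ℂ) :
    ∫ w, φ w * (G w * ((p w).toReal : ℂ)) ∂m = ∫ w, φ w * G w ∂ν := by
  have hlt := ae_lt_top_of_withDensity hp hν
  subst hν
  rw [integral_withDensity_eq_integral_toReal_smul hp hlt]
  congr 1 with w
  rw [Complex.real_smul]
  ring

/-- Pointwise |G p|² / p = |G|² p. This needs p < ∞, which holds almost everywhere because ν is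
finite; where p = 0 both sides vanish. -/
theorem spectralEnergy_mul [IsFiniteMeasure ν] (hp : Measurable p)
    (hν : ν = m.withDensity p) {G : E → ℂ} (hG : AEStronglyMeasurable G ν) :
    spectralEnergy m p (fun w => G w * ((p w).toReal : ℂ)) = ∫⁻ w, ‖G w‖ₑ ^ 2 ∂ν := by
  have hlt := ae_lt_top_of_withDensity hp hν
  subst hν
  rw [lintegral_withDensity_eq_lintegral_mul₀' hp.aemeasurable (hG.enorm.pow_const 2),
    spectralEnergy]
  refine lintegral_congr_ae ?_
  filter_upwards [hlt] with w hw
  have h1 : ‖((p w).toReal : ℂ)‖ₑ = p w := by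
    rw [← ofReal_norm, Complex.norm_real, Real.norm_of_nonneg ENNReal.toReal_nonneg,
      ENNReal.ofReal_toReal hw.ne]
  rw [enorm_mul, h1, mul_pow, Pi.mul_apply]
  rcases eq_or_ne (p w) 0 with h0 | h0
  · simp [h0]
  · rw [sq (p w), ← mul_assoc, ENNReal.mul_div_cancel_right h0 hw.ne, mul_comm]

theorem spectralEnergy_congr {F F' : E → ℂ} (h : F =ᵐ[m] F') :
    spectralEnergy m p F = spectralEnergy m p F' := by
  refine lintegral_congr_ae ?_
  filter_upwards [h] with w hw
  rw [hw]

theorem hasFourierDensity_charTransform [IsFiniteMeasure ν] (hp : Measurable p)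
    (hν : ν = m.withDensity p) {G : E → ℂ} (hG : Integrable G ν) :
    HasFourierDensity (charTransform ν G) m (fun w => G w * ((p w).toReal : ℂ)) := by
  refine ⟨?_, ?_⟩
  · have hlt := ae_lt_top_of_withDensity hp hν
    subst hν
    rw [integrable_withDensity_iff_integrable_smul' hp hlt] at hG
    refine (hG.congr (.of_forall fun w => ?_)).locallyIntegrable
    simp [Complex.real_smul, mul_comm]
  · simp only [integral_mul_density hp hν]
    exact hasGeneralizedFourier_charTransform hG

theorem lintegral_enorm_sq_Lp (G : Lp ℂ 2 ν) :
    ∫⁻ w, ‖G w‖ₑ ^ 2 ∂ν = ENNReal.ofReal (‖G‖ ^ 2) := by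
  have h := eLpNorm_nnreal_pow_eq_lintegral (f := G) (μ := ν) (p := 2) (by norm_num)
  simp only [NNReal.coe_ofNat, ENNReal.rpow_ofNat, ENNReal.coe_ofNat] at h
  rw [← h, Lp.norm_def, ← ENNReal.toReal_pow, ENNReal.ofReal_toReal]
  exact ENNReal.pow_ne_top (Lp.eLpNorm_ne_top G)

/-- A function with finite spectral energy is represented in `L²(ν)`. -/
theorem exists_Lp_of_spectralEnergy_lt_top [IsFiniteMeasure ν] (hp : Measurable p)
    (hν : ν = m.withDensity p) {f F : E → ℂ} (hf : Continuous f) (hF : HasFourierDensity f m F)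
    (hE : spectralEnergy m p F < ∞) : ∃ G : Lp ℂ 2 ν, charTransform ν G = f := by
  have hlt := ae_lt_top_of_withDensity hp hν
  have hFm : AEStronglyMeasurable F m := hF.1.aestronglyMeasurable
  have hfin : ∀ᵐ w ∂m, ‖F w‖ₑ ^ 2 / p w < ∞ :=
    ae_lt_top' ((hFm.enorm.pow_const 2).div hp.aemeasurable) hE.ne
  -- The candidate is G = F / p. Finite energy forces F = 0 almost everywhere on {p = 0}, so G p
  -- recovers F.
  have hFG : (fun w => (F w / ((p w).toReal : ℂ)) * ((p w).toReal : ℂ)) =ᵐ[m] F := by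
    filter_upwards [hlt, hfin] with w h1 h2
    refine div_mul_cancel_of_imp fun h0 => ?_
    have hp0 : p w = 0 := by
      rw [Complex.ofReal_eq_zero, ENNReal.toReal_eq_zero_iff] at h0
      exact h0.resolve_right h1.ne
    by_contra hne
    rw [hp0, ENNReal.div_zero (by simpa using hne)] at h2
    exact lt_irrefl _ h2
  have hGm : AEStronglyMeasurable (fun w => F w / ((p w).toReal : ℂ)) ν := by
    have : AEStronglyMeasurable (fun w => F w / ((p w).toReal : ℂ)) m :=
      (hFm.aemeasurable.div (by fun_prop)).aestronglyMeasurable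
    exact this.mono_ac (hν ▸ withDensity_absolutelyContinuous m p)
  have hG2 : MemLp (fun w => F w / ((p w).toReal : ℂ)) 2 ν := by
    refine ⟨hGm, ?_⟩
    have h := eLpNorm_nnreal_pow_eq_lintegral (f := fun w => F w / ((p w).toReal : ℂ))
      (μ := ν) (p := 2) (by norm_num)
    simp only [NNReal.coe_ofNat, ENNReal.rpow_ofNat, ENNReal.coe_ofNat] at h
    rw [← spectralEnergy_mul hp hν hGm, spectralEnergy_congr hFG] at h
    rw [← h] at hE
    exact (ENNReal.pow_lt_top_iff (n := 2)).1 hE |>.resolve_right (by norm_num)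
  have hGae := hG2.coeFn_toLp
  refine ⟨hG2.toLp, ?_⟩
  have hint : Integrable hG2.toLp ν := (Lp.memLp _).integrable (by norm_num)
  refine eq_of_hasGeneralizedFourier (continuous_charTransform hint) hf
    (hasGeneralizedFourier_charTransform hint) ⟨hF.2.1, fun φ hφ => ?_⟩
  refine (hF.2.2 φ hφ).trans ?_
  change ∫ w, φ w * F w ∂m = ∫ w, φ w * hG2.toLp _ w ∂ν
  rw [integral_congr_ae (hGae.mono fun w hw => by
    rw [hw]),
    ← integral_mul_density hp hν]
  exact integral_congr_ae (hFG.symm.mono fun w hw => congrArg (φ w * ·) hw)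

end Density

/-- The reproducing kernel Hilbert space with kernel `kernelOf ν` is the spectral space of `ν`. -/
theorem isSpectralSpace_of_kernel {ν : Measure E} [IsFiniteMeasure ν] {𝕜 : Type*} [RCLike 𝕜]
    (H : Type*) [NormedAddCommGroup H] [InnerProductSpace 𝕜 H] [CompleteSpace H] [RKHS 𝕜 H E 𝕜]
    (hH : ∀ x y, RCLike.map 𝕜 ℂ (RKHS.kernel H x y (1 : 𝕜)) = kernelOf ν (x - y)) :
    IsSpectralSpace H ν := by
  set v : E → H := fun x => RKHS.kerFun H x (1 : 𝕜) with hvdef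
  have hvh : ∀ x (h : H), inner 𝕜 (v x) h = h x := fun x h => by simp [hvdef]
  have hv : ∀ x y, RCLike.map 𝕜 ℂ (inner 𝕜 (v x) (v y)) = kernelOf ν (x - y) := fun x y => by
    rw [hvh, hvdef, RKHS.kerFun_apply, hH]
  have hd : DenseRange (Finsupp.linearCombination 𝕜 v) := by
    rw [denseRange_linearCombination_iff, eq_top_iff, ← RKHS.kerFun_dense H]
    refine Submodule.topologicalClosure_mono (Submodule.span_le.2 ?_)
    rintro _ ⟨x, a, rfl⟩
    have : RKHS.kerFun H x a = a • RKHS.kerFun H x (1 : 𝕜) := by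
      rw [← map_smul, smul_eq_mul, mul_one]
    rw [this]
    exact Submodule.smul_mem _ _ (Submodule.subset_span ⟨x, rfl⟩)
  intro m p _ hp hν
  have key : ∀ h : H, ∃ F : E → ℂ, Continuous (fun x => RCLike.map 𝕜 ℂ (h x)) ∧
      HasFourierDensity (fun x => RCLike.map 𝕜 ℂ (h x)) m F ∧
      spectralEnergy m p F = ENNReal.ofReal (‖h‖ ^ 2) := by
    intro h
    obtain ⟨G, hG, hGh⟩ := exists_Lp_of_gram hd hv h
    have hfun : (fun x => RCLike.map 𝕜 ℂ (h x)) = charTransform ν G := by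
      ext x
      rw [hGh, hvh]
    have hint : Integrable G ν := (Lp.memLp G).integrable (by norm_num)
    refine ⟨fun w => G w * ((p w).toReal : ℂ), ?_, ?_, ?_⟩
    · rw [hfun]
      exact continuous_charTransform hint
    · rw [hfun]
      exact hasFourierDensity_charTransform hp hν hint
    · rw [spectralEnergy_mul hp hν (Lp.aestronglyMeasurable G), lintegral_enorm_sq_Lp, hG]
  -- `RCLike.map ℂ 𝕜` is a continuous left inverse of the embedding of 𝕜 into ℂ.
  have hcont : ∀ f : E → 𝕜, Continuous (fun x => RCLike.map 𝕜 ℂ (f x)) → Continuous f := by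
    intro f hf
    have : f = fun x => RCLike.map ℂ 𝕜 (RCLike.map 𝕜 ℂ (f x)) := by
      ext x
      rw [RCLike.map_apply ℂ 𝕜, RCLike.re_eq_complex_re, RCLike.im_eq_complex_im, re_map_complex,
        im_map_complex, RCLike.re_add_im]
    rw [this]
    exact (RCLike.map ℂ 𝕜).continuous.comp hf
  refine ⟨fun f => ⟨?_, ?_⟩, fun h F hF => ?_⟩
  · rintro ⟨h, rfl⟩
    obtain ⟨F, h1, h2, h3⟩ := key h
    exact ⟨hcont _ h1, F, h2, h3 ▸ ENNReal.ofReal_lt_top⟩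
  · rintro ⟨hf, F, hF, hE⟩
    obtain ⟨G, hG⟩ := exists_Lp_of_spectralEnergy_lt_top hp hν
      ((RCLike.map 𝕜 ℂ).continuous.comp hf) hF hE
    obtain ⟨h, hh⟩ := exists_of_Lp_of_gram hd hv G (f := f) fun x => by rw [hG]; rfl
    exact ⟨h, by ext x; rw [← hvh, hh]⟩
  · obtain ⟨F', -, h2, h3⟩ := key h
    rw [← h3, spectralEnergy_congr (hF.ae_eq h2)]

end StationaryKernel

end

noncomputable section

open Filter Topology
open scoped RealInnerProductSpace

namespace StationaryKernel

/-! ### From weak to norm continuity -/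

section ContinuousGram

variable {X : Type*} [TopologicalSpace X] {ι : Type*} {V : Type*} [NormedAddCommGroup V]
  [InnerProductSpace ℝ V]

/-- A weakly continuous map into a sphere is continuous. -/
theorem continuous_of_weak {v : ι → V} {g : X → V} {C : ℝ} (hC : ∀ y, ‖g y‖ = C)
    (hmem : ∀ y, g y ∈ (Submodule.span ℝ (Set.range v)).topologicalClosure)
    (hw : ∀ i, Continuous fun y => ⟪v i, g y⟫) : Continuous g := by
  have hspan : ∀ u ∈ Submodule.span ℝ (Set.range v), Continuous fun y => ⟪u, g y⟫ := by
    intro u hu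
    induction hu using Submodule.span_induction with
    | mem u hu => obtain ⟨i, rfl⟩ := hu; exact hw i
    | zero => simpa using continuous_const
    | add a b _ _ ha hb => simp only [inner_add_left]; exact ha.add hb
    | smul r a _ ha => simp only [real_inner_smul_left]; exact ha.const_mul r
  -- Replacing `g y₀` by a nearby vector `u` of the span changes the inner product uniformly little,
  -- as ‖g y‖ = C; the `+ 1` below avoids division by zero.
  have hweak : ∀ y₀, Continuous fun y => ⟪g y₀, g y⟫ := by
    intro y₀
    refine continuous_of_uniform_approx_of_continuous fun s hs => ?_
    obtain ⟨ε, hε, hs⟩ := Metric.mem_uniformity_dist.1 hs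
    have hC0 : 0 ≤ C := hC y₀ ▸ norm_nonneg _
    obtain ⟨u, hu, hdist⟩ := Metric.mem_closure_iff.1 (hmem y₀) (ε / (C + 1)) (by positivity)
    refine ⟨_, hspan u hu, fun y => hs ?_⟩
    rw [Real.dist_eq, ← inner_sub_left]
    refine (abs_real_inner_le_norm _ _).trans_lt ?_
    rw [hC, ← dist_eq_norm]
    have h1 : dist (g y₀) u * (C + 1) < ε := (lt_div_iff₀ (by positivity)).1 hdist
    nlinarith [dist_nonneg (x := g y₀) (y := u)]
  rw [continuous_iff_continuousAt]
  intro y₀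
  -- Constant norms give ‖g y - g y₀‖² = 2C² - 2⟪g y₀, g y⟫.
  have h1 : Tendsto (fun y => 2 * C ^ 2 - 2 * ⟪g y₀, g y⟫) (𝓝 y₀) (𝓝 0) := by
    have h := (((hweak y₀).tendsto y₀).const_mul 2).const_sub (2 * C ^ 2)
    rwa [real_inner_self_eq_norm_sq, hC, sub_self] at h
  have h2 : Tendsto (fun y => ‖g y - g y₀‖ ^ 2) (𝓝 y₀) (𝓝 0) := by
    refine h1.congr fun y => ?_
    rw [norm_sub_sq_real, hC, hC, real_inner_comm]
    ring
  have h3 := h2.sqrt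
  simp only [Real.sqrt_sq (norm_nonneg _), Real.sqrt_zero] at h3
  exact tendsto_iff_norm_sub_tendsto_zero.2 h3

end ContinuousGram

/-! ### Continuous decompositions from arbitrary ones -/

variable {E : Type u} [NormedAddCommGroup E]

theorem IsPositiveDefinite.symm {κ : E → ℝ} (hκ : IsPositiveDefinite κ) (x y : E) :
    κ (x - y) = κ (y - x) := by
  have := hκ.1.apply x y
  simpa using this.symm

theorem IsPositiveDefinite.add {κ κ' : E → ℝ} (hκ : IsPositiveDefinite κ)
    (hκ' : IsPositiveDefinite κ') : IsPositiveDefinite fun z => κ z + κ' z :=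
  Matrix.PosSemidef.add hκ hκ'

/-- A continuous difference of positive definite functions is a difference of continuous
positive definite functions, given as Gram matrices of continuous families of vectors. -/
theorem HasPositiveDecomposition.exists_continuous_gram {k : E → ℝ} (hk : Continuous k)
    (h : HasPositiveDecomposition k) :
    ∃ (V : Type u) (_ : NormedAddCommGroup V) (_ : InnerProductSpace ℝ V) (_ : CompleteSpace V)
      (v₁ v₂ : E → V) (q₁ q₂ : E → ℝ), Continuous v₁ ∧ Continuous v₂ ∧
      (∀ x y, ⟪v₁ x, v₁ y⟫ = q₁ (x - y)) ∧ (∀ x y, ⟪v₂ x, v₂ y⟫ = q₂ (x - y)) ∧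
      ∀ z, k z = q₁ z - q₂ z := by
  obtain ⟨kp, km, hp, hm, hpm⟩ := h
  have ksymm : ∀ x y, k (x - y) = k (y - x) := fun x y => by
    rw [hpm, hpm, hp.symm, hm.symm]
  obtain ⟨Vp, _, _, _, vp, hvp, -⟩ := hp.exists_gram
  obtain ⟨Vm, _, _, _, vm, hvm, -⟩ := hm.exists_gram
  obtain ⟨V, i1, i2, i3, v, hv, hd⟩ := (hp.add hm).exists_gram
  -- The Gram matrix of `v` is the sum of those of `vp` and `vm`; hence `v x ↦ vp x` and `v x ↦ vm
  -- x` extend to contractions.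
  have hsq : ∀ c : E →₀ ℝ, ‖Finsupp.linearCombination ℝ v c‖ ^ 2 =
      ‖Finsupp.linearCombination ℝ vp c‖ ^ 2 + ‖Finsupp.linearCombination ℝ vm c‖ ^ 2 := fun c => by
    simp only [← real_inner_self_eq_norm_sq, inner_linearCombination, hv, hvp, hvm, mul_add,
      add_mul, Finsupp.sum, Finset.sum_add_distrib]
  have hlep : ∀ c : E →₀ ℝ, ‖Finsupp.linearCombination ℝ vp c‖ ≤
      ‖Finsupp.linearCombination ℝ v c‖ := fun c =>
    (sq_le_sq₀ (norm_nonneg _) (norm_nonneg _)).1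
      ((le_add_of_nonneg_right (sq_nonneg _)).trans_eq (hsq c).symm)
  have hlem : ∀ c : E →₀ ℝ, ‖Finsupp.linearCombination ℝ vm c‖ ≤
      ‖Finsupp.linearCombination ℝ v c‖ := fun c =>
    (sq_le_sq₀ (norm_nonneg _) (norm_nonneg _)).1
      ((le_add_of_nonneg_left (sq_nonneg _)).trans_eq (hsq c).symm)
  -- the functions `k (· - y)` as elements of the Hilbert space
  have hex : ∀ y, ∃ g : V, ∀ x, ⟪v x, g⟫ = k (x - y) := by
    intro y
    refine exists_inner_eq_of_norm_le hd (C := ‖vp y‖ + ‖vm y‖) fun c => ?_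
    have e : (c.sum fun i a => a * starRingEnd ℝ (k (i - y))) =
        ⟪Finsupp.linearCombination ℝ vp c, vp y⟫ - ⟪Finsupp.linearCombination ℝ vm c, vm y⟫ := by
      simp only [Finsupp.linearCombination_apply, Finsupp.sum, sum_inner, real_inner_smul_left, hvp,
        hvm, hpm, ← Finset.sum_sub_distrib, mul_sub, conj_trivial]
    rw [e]
    refine (norm_sub_le _ _).trans ?_
    have h1 := norm_inner_le_norm (𝕜 := ℝ) (Finsupp.linearCombination ℝ vp c) (vp y)
    have h2 := norm_inner_le_norm (𝕜 := ℝ) (Finsupp.linearCombination ℝ vm c) (vm y)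
    nlinarith [mul_le_mul_of_nonneg_right (hlep c) (norm_nonneg (vp y)),
      mul_le_mul_of_nonneg_right (hlem c) (norm_nonneg (vm y))]
  choose g hg using hex
  -- translations
  have hT : ∀ z, ∃ T : V →ₗᵢ[ℝ] V, ∀ x, T (v x) = v (x + z) := fun z =>
    exists_linearIsometry_of_gram hd fun x y => by rw [hv, hv, add_sub_add_right_eq_sub]
  choose T hTv using hT
  have ext_v : ∀ a b : V, (∀ x, ⟪v x, a⟫ = ⟪v x, b⟫) → a = b := by
    intro a b hab
    refine hd.eq_of_inner_left ℝ fun c => ?_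
    simp only [Finsupp.linearCombination_apply, Finsupp.sum, inner_sum, real_inner_smul_right,
      real_inner_comm (v _), hab]
  have hTg : ∀ z y, T z (g y) = g (y + z) := fun z y => by
    refine ext_v _ _ fun x => ?_
    have : v x = T z (v (x - z)) := by rw [hTv, sub_add_cancel]
    rw [hg, this, (T z).inner_map_map, hg]
    congr 1
    abel
  have hgnorm : ∀ y, ‖g y‖ = ‖g 0‖ := fun y => by
    rw [← (T y).norm_map (g 0), hTg, zero_add]
  have hgc : Continuous g := by
    refine continuous_of_weak (v := v) hgnorm (fun y => ?_) fun x => ?_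
    · rw [denseRange_linearCombination_iff.1 hd]
      trivial
    · simp only [hg]
      exact hk.comp (continuous_const.sub continuous_id)
  -- the projection to the span of these functions
  set L : Submodule ℝ V := (Submodule.span ℝ (Set.range g)).topologicalClosure with hL
  have hLcl : IsClosed (L : Set V) := Submodule.isClosed_topologicalClosure _
  have : CompleteSpace L := hLcl.completeSpace_coe
  have hgL : ∀ y, g y ∈ L := fun y =>
    Submodule.le_topologicalClosure _ (Submodule.subset_span ⟨y, rfl⟩)
  -- `v` itself may be discontinuous. Its projection lies in the closed span of `g`, where weak
  -- continuity need only be tested against `g`, and there the inner products are values of k.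
  set e : E → V := fun y => L.starProjection (v y) with he
  have heL : ∀ y, e y ∈ L := fun y => Submodule.starProjection_apply_mem _ _
  have heg : ∀ x y, ⟪e x, g y⟫ = k (x - y) := fun x y => by
    rw [he, Submodule.inner_starProjection_left_eq_right,
      Submodule.starProjection_eq_self_iff.2 (hgL y), hg]
  have ext_g : ∀ a ∈ L, ∀ b ∈ L, (∀ x, ⟪a, g x⟫ = ⟪b, g x⟫) → a = b := by
    intro a ha b hb hab
    have hle : Submodule.span ℝ (Set.range g) ≤ (LinearMap.ker (innerSL ℝ (a - b)).toLinearMap) := by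
      refine Submodule.span_le.2 ?_
      rintro _ ⟨x, rfl⟩
      simp [hab]
    have hle' : L ≤ LinearMap.ker (innerSL ℝ (a - b)).toLinearMap :=
      Submodule.topologicalClosure_minimal _ hle (innerSL ℝ (a - b)).isClosed_ker
    have := hle' (L.sub_mem ha hb)
    simp only [LinearMap.mem_ker, ContinuousLinearMap.coe_coe, innerSL_apply_apply] at this
    exact sub_eq_zero.1 (inner_self_eq_zero.1 this)
  have hTL : ∀ z, ∀ u ∈ L, T z u ∈ L := by
    intro z
    have : L ≤ L.comap (T z).toLinearMap := by
      refine Submodule.topologicalClosure_minimal _ (Submodule.span_le.2 ?_)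
        (hLcl.preimage (T z).continuous)
      rintro _ ⟨x, rfl⟩
      simp only [SetLike.mem_coe, Submodule.mem_comap]
      change T z (g x) ∈ L
      rw [hTg]
      exact hgL _
    exact this
  have hTe : ∀ z y, T z (e y) = e (y + z) := fun z y => by
    refine ext_g _ (hTL z _ (heL y)) _ (heL _) fun x => ?_
    have : g x = T z (g (x - z)) := by rw [hTg, sub_add_cancel]
    rw [heg, this, (T z).inner_map_map, heg]
    congr 1
    abel
  have henorm : ∀ y, ‖e y‖ = ‖e 0‖ := fun y => by
    rw [← (T y).norm_map (e 0), hTe, zero_add]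
  have hec : Continuous e := by
    refine continuous_of_weak (v := g) henorm heL fun x => ?_
    simp only [real_inner_comm (e _), heg]
    exact hk.comp (continuous_id.sub continuous_const)
  -- A family that the translations permute has a Gram matrix depending only on x - y.
  have gram : ∀ w : E → V, (∀ z y, T z (w y) = w (y + z)) →
      ∀ x y, ⟪w x, w y⟫ = ⟪w (x - y), w 0⟫ := by
    intro w hw x y
    rw [← (T y).inner_map_map (w (x - y)), hw, hw, sub_add_cancel, zero_add]
  -- Polarization: q₁(z) - q₂(z) = (⟪e z, g 0⟫ + ⟪g z, e 0⟫) / 2 = (k(z) + k(-z)) / 2, and k is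
  -- even.
  refine ⟨V, i1, i2, i3, fun x => (1 / 2 : ℝ) • (e x + g x), fun x => (1 / 2 : ℝ) • (e x - g x),
    fun x => ⟪(1 / 2 : ℝ) • (e x + g x), (1 / 2 : ℝ) • (e 0 + g 0)⟫,
    fun x => ⟪(1 / 2 : ℝ) • (e x - g x), (1 / 2 : ℝ) • (e 0 - g 0)⟫,
    by fun_prop, by fun_prop, gram _ fun z y => ?_, gram _ fun z y => ?_, fun z => ?_⟩
  · rw [map_smul, map_add, hTe, hTg]
  · rw [map_smul, map_sub, hTe, hTg]
  · have h1 := heg z 0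
    have h2 := heg 0 z
    rw [ksymm, sub_zero, real_inner_comm] at h2
    rw [sub_zero] at h1
    simp only [real_inner_smul_left, real_inner_smul_right, inner_add_left, inner_add_right,
      inner_sub_left, inner_sub_right, h1, h2]
    ring

end StationaryKernel

end

noncomputable section

open Filter Topology
open scoped RealInnerProductSpace

namespace StationaryKernel

set_option linter.unusedSectionVars false

variable {E : Type*} [NormedAddCommGroup E] [InnerProductSpace ℝ E] [FiniteDimensional ℝ E]
  [MeasurableSpace E] [BorelSpace E]

/-! ### Limits of Fourier transforms of probability measures -/

section Limit

theorem kernelOf_eq_charFun (ν : Measure E) (z : E) :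
    kernelOf ν z = charFun ν ((2 * Real.pi) • z) := by
  rw [kernelOf, charFun_apply]
  congr 1 with w
  rw [inner_smul_right]
  congr 1
  push_cast
  ring

/-- A continuous pointwise limit of Fourier transforms of probability measures is the Fourier
transform of a probability measure. -/
theorem exists_kernelOf_eq_of_tendsto {P : ℕ → Measure E} [∀ n, IsProbabilityMeasure (P n)]
    {f : E → ℂ} (hf : Continuous f) (h : ∀ z, Tendsto (fun n => kernelOf (P n) z) atTop (𝓝 (f z))) :
    ∃ ν : Measure E, IsProbabilityMeasure ν ∧ ∀ z, kernelOf ν z = f z := by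
  have hpi : (2 * Real.pi) ≠ 0 := by positivity
  have hchar : ∀ t, Tendsto (fun n => charFun (P n) t) atTop (𝓝 (f ((2 * Real.pi)⁻¹ • t))) := by
    intro t
    have := h ((2 * Real.pi)⁻¹ • t)
    simpa only [kernelOf_eq_charFun, smul_smul, mul_inv_cancel₀ hpi, one_smul] using this
  -- Continuity of the limit at 0 prevents mass from escaping to infinity; Prokhorov's theorem then
  -- gives compactness.
  have htight := isTightMeasureSet_of_tendsto_charFun
    (hf.comp (continuous_const_smul ((2 * Real.pi)⁻¹))).continuousAt hchar
  let Q : ℕ → ProbabilityMeasure E := fun n => ⟨P n, inferInstance⟩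
  have hcomp : IsCompact (closure (Set.range Q)) := by
    refine isCompact_closure_of_isTightMeasureSet (htight.subset ?_)
    rintro _ ⟨_, ⟨n, rfl⟩, rfl⟩
    exact ⟨n, rfl⟩
  -- An ultrafilter finer than `atTop` takes the place of a convergent subsequence.
  let U : Ultrafilter ℕ := Ultrafilter.of atTop
  have hU : (U : Filter ℕ) ≤ atTop := Ultrafilter.of_le atTop
  obtain ⟨ν, -, hν⟩ := hcomp.ultrafilter_le_nhds (U.map Q) (le_principal_iff.2
    (Ultrafilter.mem_map.2 (univ_mem' fun n => subset_closure ⟨n, rfl⟩)))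
  have hlim : Tendsto Q U (𝓝 ν) := hν
  refine ⟨ν, inferInstance, fun z => ?_⟩
  have h1 := (ProbabilityMeasure.tendsto_iff_forall_integral_rclike_tendsto ℂ).1 hlim
    (BoundedContinuousFunction.ofNormedAddCommGroup
      (fun w => Complex.exp (2 * Real.pi * Complex.I * (⟪w, z⟫ : ℝ))) (by fun_prop) 1 fun w => by
        rw [show 2 * Real.pi * Complex.I * ((⟪w, z⟫ : ℝ) : ℂ) =
          ((2 * Real.pi * ⟪w, z⟫ : ℝ) : ℂ) * Complex.I by push_cast; ring,
          Complex.norm_exp_ofReal_mul_I])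
  exact tendsto_nhds_unique h1 ((h z).mono_left hU)

end Limit

/-! ### Gaussian integrals -/

section Gaussian

theorem integrable_gaussian {b : ℝ} (hb : 0 < b) :
    Integrable fun v : E => Real.exp (-b * ‖v‖ ^ 2) := by
  have h := (GaussianFourier.integrable_cexp_neg_mul_sq_norm_add (V := E) (b := (b : ℂ)) (by simpa)
    0 0).norm
  refine h.congr (.of_forall fun v => ?_)
  simp only [zero_mul, add_zero]
  rw [show -(b : ℂ) * (‖v‖ : ℂ) ^ 2 = ((-b * ‖v‖ ^ 2 : ℝ) : ℂ) by push_cast; ring,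
    ← Complex.ofReal_exp, Complex.norm_real, Real.norm_of_nonneg (Real.exp_pos _).le]

theorem integral_gaussian_pos {b : ℝ} (hb : 0 < b) :
    0 < ∫ v : E, Real.exp (-b * ‖v‖ ^ 2) := by
  rw [GaussianFourier.integral_rexp_neg_mul_sq_norm hb]
  positivity

/-- The transform of a Gaussian is positive, so its L¹ norm is its integral, which is the value 1 of
the Gaussian at 0. -/
theorem integral_norm_fourier_gaussian {c : ℝ} (hc : 0 < c) :
    Integrable (𝓕 fun v : E => Complex.exp (-(c : ℂ) * ‖v‖ ^ 2)) ∧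
      ∫ z, ‖𝓕 (fun v : E => Complex.exp (-(c : ℂ) * ‖v‖ ^ 2)) z‖ = 1 := by
  have hval : ∀ z, 𝓕 (fun v : E => Complex.exp (-(c : ℂ) * ‖v‖ ^ 2)) z =
      (((Real.pi / c) ^ (Module.finrank ℝ E / 2 : ℝ) * Real.exp (-(Real.pi ^ 2 / c) * ‖z‖ ^ 2) : ℝ)
        : ℂ) := by
    intro z
    rw [fourier_gaussian_innerProductSpace (by simpa)]
    push_cast
    rw [Complex.ofReal_cpow (by positivity)]
    push_cast
    congr 2
    ring
  have hc' : 0 < Real.pi ^ 2 / c := by positivity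
  constructor
  · simp only [funext hval]
    exact ((integrable_gaussian hc').const_mul _).ofReal
  · simp only [hval, Complex.norm_real]
    rw [integral_congr_ae (.of_forall fun z => Real.norm_of_nonneg (by positivity)),
      integral_const_mul, GaussianFourier.integral_rexp_neg_mul_sq_norm hc',
      ← Real.mul_rpow (by positivity) (by positivity)]
    rw [show Real.pi / c * (Real.pi / (Real.pi ^ 2 / c)) = 1 by field_simp, Real.one_rpow]

end Gaussian

/-! ### Positivity of Gaussian-weighted integrals -/

section Positivity

variable {V : Type*} [NormedAddCommGroup V] [InnerProductSpace ℝ V] [CompleteSpace V]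
  {w : E → V} {q : E → ℝ}

theorem norm_sq_eq_of_gram (hq : ∀ x y, ⟪w x, w y⟫ = q (x - y)) (x : E) : ‖w x‖ ^ 2 = q 0 := by
  rw [← real_inner_self_eq_norm_sq, hq, sub_self]

theorem abs_le_of_gram (hq : ∀ x y, ⟪w x, w y⟫ = q (x - y)) (z : E) : |q z| ≤ q 0 := by
  have h := abs_real_inner_le_norm (w z) (w 0)
  rw [hq, sub_zero] at h
  nlinarith [norm_sq_eq_of_gram hq z, norm_sq_eq_of_gram hq 0, sq_nonneg (‖w z‖ - ‖w 0‖)]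

theorem continuous_of_gram (hw : Continuous w) (hq : ∀ x y, ⟪w x, w y⟫ = q (x - y)) :
    Continuous q := by
  have : q = fun z => ⟪w z, w 0⟫ := by ext z; rw [hq, sub_zero]
  rw [this]
  fun_prop

theorem even_of_gram (hq : ∀ x y, ⟪w x, w y⟫ = q (x - y)) (z : E) : q (-z) = q z := by
  rw [← zero_sub, ← hq, real_inner_comm, hq, sub_zero]

/-- Up to a positive constant, the integral is the squared norm of ∫ exp(-b‖x‖²) w(x) dx: with z = x
- y, completing the square gives ‖z + y‖² + ‖y‖² = 2‖y + z/2‖² + ‖z‖²/2, and the integral over y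
splits off. -/
theorem integral_mul_gaussian_nonneg (hw : Continuous w) (hq : ∀ x y, ⟪w x, w y⟫ = q (x - y))
    {b : ℝ} (hb : 0 < b) : 0 ≤ ∫ z, q z * Real.exp (-(b / 2) * ‖z‖ ^ 2) := by
  have hqc := continuous_of_gram hw hq
  set γ : E → ℝ := fun x => Real.exp (-b * ‖x‖ ^ 2) with hγ
  have hγc : Continuous γ := by fun_prop
  have hγi : Integrable γ := integrable_gaussian hb
  have hwn : ∀ x, ‖w x‖ = Real.sqrt (q 0) := fun x => by
    rw [← norm_sq_eq_of_gram hq x, Real.sqrt_sq (norm_nonneg _)]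
  have hint : Integrable fun x => γ x • w x := by
    refine (hγi.norm.mul_const (Real.sqrt (q 0))).mono' (by fun_prop : Continuous _).aestronglyMeasurable
      (.of_forall fun x => ?_)
    rw [norm_smul, hwn]
  have e1 : ⟪∫ x, γ x • w x, ∫ x, γ x • w x⟫ = ∫ y, ∫ z, q z * (γ (z + y) * γ y) := by
    rw [← integral_inner hint]
    congr 1 with y
    rw [real_inner_comm, ← integral_inner hint,
      ← integral_add_right_eq_self (fun x => ⟪γ y • w y, γ x • w x⟫) y]
    congr 1 with z
    rw [real_inner_smul_left, real_inner_smul_right, real_inner_comm, hq, add_sub_cancel_right]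
    ring
  have hprod : Integrable (Function.uncurry fun y z : E => q z * (γ (z + y) * γ y))
      (volume.prod volume) := by
    have hb4 : 0 < b / 4 := by positivity
    have hb2 : 0 < b / 2 := by positivity
    refine (((integrable_gaussian (E := E) hb2).mul_prod
      (integrable_gaussian (E := E) hb4)).const_mul (q 0)).mono'
      (Continuous.aestronglyMeasurable (by unfold Function.uncurry; fun_prop))
      (.of_forall fun ⟨y, z⟩ => ?_)
    simp only [Function.uncurry_apply_pair, hγ]
    rw [norm_mul, Real.norm_eq_abs, Real.norm_of_nonneg (by positivity), ← Real.exp_add,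
      ← Real.exp_add]
    refine mul_le_mul (abs_le_of_gram hq z) (Real.exp_le_exp.2 ?_) (Real.exp_pos _).le
      ((abs_nonneg _).trans (abs_le_of_gram hq z))
    · have h1 : ‖z‖ ≤ ‖z + y‖ + ‖y‖ := by simpa using norm_sub_le (z + y) y
      have h2 : ‖z‖ ^ 2 ≤ 2 * ‖z + y‖ ^ 2 + 2 * ‖y‖ ^ 2 := by
        nlinarith [norm_nonneg z, norm_nonneg (z + y), norm_nonneg y,
          sq_nonneg (‖z + y‖ - ‖y‖)]
      nlinarith [sq_nonneg ‖z + y‖, mul_le_mul_of_nonneg_left h2 hb.le,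
        mul_nonneg hb.le (sq_nonneg ‖z + y‖)]
  have e2 : ∀ z, ∫ y, q z * (γ (z + y) * γ y) =
      (q z * Real.exp (-(b / 2) * ‖z‖ ^ 2)) * ∫ y : E, Real.exp (-(2 * b) * ‖y‖ ^ 2) := by
    intro z
    rw [← integral_const_mul,
      ← integral_add_right_eq_self (fun y : E => _ * Real.exp (-(2 * b) * ‖y‖ ^ 2))
        ((1 / 2 : ℝ) • z)]
    congr 1 with y
    simp only [hγ]
    rw [mul_assoc, ← Real.exp_add, ← Real.exp_add]
    congr 2
    rw [norm_add_sq_real, norm_add_sq_real, inner_smul_right, norm_smul, Real.norm_of_nonneg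
      (by norm_num), real_inner_comm]
    ring
  have h0 : 0 ≤ ⟪∫ x, γ x • w x, ∫ x, γ x • w x⟫ := real_inner_self_nonneg
  rw [e1, integral_integral_swap hprod] at h0
  simp only [e2, integral_mul_const] at h0
  exact nonneg_of_mul_nonneg_left h0 (integral_gaussian_pos (by positivity))

/-- Multiplication by the cosine preserves Gram functions: by the addition formula, the vectors (cos
· w, sin · w) in V × V realize the product. -/
theorem integral_mul_gaussian_mul_cos_nonneg (hw : Continuous w)
    (hq : ∀ x y, ⟪w x, w y⟫ = q (x - y)) {b : ℝ} (hb : 0 < b) (ξ : E) :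
    0 ≤ ∫ z, (q z * Real.cos (2 * Real.pi * ⟪z, ξ⟫)) * Real.exp (-(b / 2) * ‖z‖ ^ 2) := by
  refine integral_mul_gaussian_nonneg (V := WithLp 2 (V × V))
    (w := fun x => WithLp.toLp 2 (Real.cos (2 * Real.pi * ⟪x, ξ⟫) • w x,
      Real.sin (2 * Real.pi * ⟪x, ξ⟫) • w x)) (q := fun z => q z * Real.cos (2 * Real.pi * ⟪z, ξ⟫))
    (by fun_prop) (fun x y => ?_) hb
  rw [WithLp.prod_inner_apply]
  simp only [real_inner_smul_left, real_inner_smul_right, hq, inner_sub_left, mul_sub, Real.cos_sub]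
  ring

end Positivity

/-! ### Bochner's theorem -/

section Bochner

variable {V : Type*} [NormedAddCommGroup V] [InnerProductSpace ℝ V] [CompleteSpace V]
  {w : E → V} {q : E → ℝ}

/-- An integrable bounded continuous function with nonnegative Fourier transform is the Fourier
transform of a finite measure. -/
theorem exists_kernelOf_eq_of_fourier_nonneg {u : E → ℂ} (hu : Continuous u) (hui : Integrable u)
    {M : ℝ} (hM : ∀ z, ‖u z‖ ≤ M) {R : E → ℝ} (hR : ∀ ξ, 0 ≤ R ξ) (hF : ∀ ξ, 𝓕 u ξ = R ξ) :
    ∃ ν : Measure E, IsFiniteMeasure ν ∧ ∀ z, kernelOf ν z = u z := by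
  have hFc : Continuous (𝓕 u) := VectorFourier.fourierIntegral_continuous
    Real.continuous_fourierChar (by simp only [innerₗ_apply_apply]; fun_prop) hui
  have hRc : Continuous R := by
    have : R = fun ξ => (𝓕 u ξ).re := by ext ξ; rw [hF, Complex.ofReal_re]
    rw [this]
    fun_prop
  -- Pairing `𝓕 u` with a Gaussian equals pairing `u` with the transform of the Gaussian, which has
  -- L¹ norm 1; so `M` is a bound independent of c.
  have bound : ∀ c : ℝ, 0 < c →
      ∫⁻ ξ, ENNReal.ofReal (R ξ * Real.exp (-c * ‖ξ‖ ^ 2)) ≤ ENNReal.ofReal M := by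
    intro c hc
    obtain ⟨hgi, hg1⟩ := integral_norm_fourier_gaussian (E := E) hc
    set g : E → ℂ := fun v => Complex.exp (-(c : ℂ) * ‖v‖ ^ 2) with hg
    have hge : ∀ v, g v = (Real.exp (-c * ‖v‖ ^ 2) : ℝ) := fun v => by
      rw [hg]; push_cast; rfl
    have hgint : Integrable g := by
      simp only [funext hge]
      exact (integrable_gaussian hc).ofReal
    have key : ∫ ξ, 𝓕 u ξ • g ξ = ∫ z, u z • 𝓕 g z := by
      have := VectorFourier.integral_fourierIntegral_smul_eq_flip (e := Real.fourierChar)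
        (μ := (volume : Measure E)) (ν := (volume : Measure E)) (L := innerₗ E) (f := u) (g := g)
        Real.continuous_fourierChar (by simp only [innerₗ_apply_apply]; fun_prop) hui hgint
      rwa [flip_innerₗ] at this
    have hle : ‖∫ z, u z • 𝓕 g z‖ ≤ M := by
      refine (norm_integral_le_of_norm_le (hgi.norm.const_mul M) (.of_forall fun z => ?_)).trans_eq
        (by rw [integral_const_mul, hg1, mul_one])
      rw [norm_smul]
      gcongr
      exact hM z
    have hreal : ∫ ξ, 𝓕 u ξ • g ξ = ((∫ ξ, R ξ * Real.exp (-c * ‖ξ‖ ^ 2) : ℝ) : ℂ) := by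
      rw [← integral_complex_ofReal]
      congr 1 with ξ
      rw [hF, hge, smul_eq_mul]
      push_cast
      rfl
    have hRi : Integrable fun ξ => R ξ * Real.exp (-c * ‖ξ‖ ^ 2) := by
      refine ((integrable_gaussian hc).const_mul (∫ z, ‖u z‖)).mono'
        (Continuous.aestronglyMeasurable (by fun_prop)) (.of_forall fun ξ => ?_)
      have h1 : ‖𝓕 u ξ‖ ≤ ∫ z, ‖u z‖ :=
        VectorFourier.norm_fourierIntegral_le_integral_norm _ _ _ _ _
      rw [hF, Complex.norm_real] at h1
      rw [norm_mul, Real.norm_of_nonneg (Real.exp_pos _).le]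
      gcongr
    rw [← ofReal_integral_eq_lintegral_ofReal hRi (.of_forall fun ξ =>
      mul_nonneg (hR ξ) (Real.exp_pos _).le)]
    refine ENNReal.ofReal_le_ofReal ?_
    rw [← key, hreal, Complex.norm_real] at hle
    exact (le_abs_self _).trans hle
  -- Fatou's lemma as c → 0. Nonnegativity of `R` turns the uniform bound into integrability, as
  -- inversion requires.
  have hfin : ∫⁻ ξ, ENNReal.ofReal (R ξ) ≤ ENNReal.ofReal M := by
    have hlim : ∀ ξ, ENNReal.ofReal (R ξ) = liminf (fun n : ℕ =>
        ENNReal.ofReal (R ξ * Real.exp (-(1 / ((n : ℝ) + 1)) * ‖ξ‖ ^ 2))) atTop := by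
      intro ξ
      refine (Tendsto.liminf_eq ?_).symm
      refine ENNReal.tendsto_ofReal ?_
      have h1 := ((tendsto_one_div_add_atTop_nhds_zero_nat (𝕜 := ℝ)).neg.mul_const (‖ξ‖ ^ 2)).rexp
      have h2 := h1.const_mul (R ξ)
      simpa using h2
    simp only [hlim]
    refine (lintegral_liminf_le fun n => by fun_prop).trans ?_
    refine liminf_le_of_le (by isBoundedDefault) fun a ha => ?_
    obtain ⟨n, hn⟩ := ha.exists
    exact hn.trans (bound _ (by positivity))
  have hRi : Integrable R := by
    refine ⟨hRc.aestronglyMeasurable, ?_⟩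
    rw [hasFiniteIntegral_iff_ofReal (.of_forall hR)]
    exact hfin.trans_lt ENNReal.ofReal_lt_top
  have hFi : Integrable (𝓕 u) := by
    rw [funext hF]
    exact hRi.ofReal
  refine ⟨volume.withDensity fun ξ => ENNReal.ofReal (R ξ),
    isFiniteMeasure_withDensity_ofReal hRi.2, fun z => ?_⟩
  rw [kernelOf_eq, integral_withDensity_eq_integral_toReal_smul (by fun_prop)
    (.of_forall fun ξ => ENNReal.ofReal_lt_top)]
  have hinv : 𝓕⁻ (𝓕 u) z = u z := congrFun (hu.fourierInv_fourier_eq hui hFi) z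
  rw [← hinv, Real.fourierInv_eq]
  congr 1 with ξ
  rw [hF, ENNReal.toReal_ofReal (hR ξ), Complex.real_smul, Circle.smul_def, smul_eq_mul, mul_comm]

theorem exists_kernelOf_eq_mul_gaussian (hw : Continuous w) (hq : ∀ x y, ⟪w x, w y⟫ = q (x - y))
    {b : ℝ} (hb : 0 < b) : ∃ ν : Measure E, IsFiniteMeasure ν ∧
      ∀ z, kernelOf ν z = ((q z * Real.exp (-(b / 2) * ‖z‖ ^ 2) : ℝ) : ℂ) := by
  have hqc := continuous_of_gram hw hq
  have hb2 : 0 < b / 2 := by positivity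
  have hri : Integrable fun z : E => q z * Real.exp (-(b / 2) * ‖z‖ ^ 2) := by
    refine ((integrable_gaussian hb2).const_mul (q 0)).mono'
      (Continuous.aestronglyMeasurable (by fun_prop)) (.of_forall fun z => ?_)
    rw [norm_mul, Real.norm_of_nonneg (Real.exp_pos _).le]
    gcongr
    exact abs_le_of_gram hq z
  have hui : Integrable fun z : E => ((q z * Real.exp (-(b / 2) * ‖z‖ ^ 2) : ℝ) : ℂ) := hri.ofReal
  refine exists_kernelOf_eq_of_fourier_nonneg (M := q 0) (by fun_prop) hui (fun z => ?_)
    (integral_mul_gaussian_mul_cos_nonneg hw hq hb) fun ξ => ?_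
  · rw [Complex.norm_real, norm_mul, Real.norm_of_nonneg (Real.exp_pos _).le]
    have h1 := abs_le_of_gram hq z
    have h2 : Real.exp (-(b / 2) * ‖z‖ ^ 2) ≤ 1 := by
      rw [Real.exp_le_one_iff]
      nlinarith [sq_nonneg ‖z‖]
    calc _ ≤ q 0 * 1 :=
          mul_le_mul h1 h2 (Real.exp_pos _).le ((abs_nonneg _).trans h1)
      _ = q 0 := mul_one _
  · have hi := (Real.fourierIntegral_convergent_iff ξ).2 hui
    have hval : ∀ z : E, Real.fourierChar (-⟪z, ξ⟫) •
        ((q z * Real.exp (-(b / 2) * ‖z‖ ^ 2) : ℝ) : ℂ) =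
        (((q z * Real.cos (2 * Real.pi * ⟪z, ξ⟫)) * Real.exp (-(b / 2) * ‖z‖ ^ 2) : ℝ) : ℂ) -
        (((q z * Real.sin (2 * Real.pi * ⟪z, ξ⟫)) * Real.exp (-(b / 2) * ‖z‖ ^ 2) : ℝ) : ℂ)
          * Complex.I := by
      intro z
      rw [Circle.smul_def, Real.fourierChar_apply, mul_neg, Complex.ofReal_neg, Complex.exp_mul_I,
        Complex.cos_neg, Complex.sin_neg, smul_eq_mul]
      push_cast
      ring
    have hre : ∀ s t : ℝ, RCLike.re ((s : ℂ) - t * Complex.I) = s := by simp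
    have him : ∀ s t : ℝ, RCLike.im ((s : ℂ) - t * Complex.I) = -t := by simp
    rw [Real.fourier_eq]
    apply Complex.ext
    · rw [Complex.ofReal_re, ← RCLike.re_eq_complex_re, ← integral_re hi]
      congr 1 with z
      rw [hval, hre]
    · rw [Complex.ofReal_im, ← RCLike.im_eq_complex_im, ← integral_im hi]
      -- `q` is even and the sine is odd, so the imaginary part integrates to zero.
      have hodd : ∀ z : E, RCLike.im (Real.fourierChar (-⟪-z, ξ⟫) •
          ((q (-z) * Real.exp (-(b / 2) * ‖-z‖ ^ 2) : ℝ) : ℂ)) =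
          -RCLike.im (Real.fourierChar (-⟪z, ξ⟫) •
          ((q z * Real.exp (-(b / 2) * ‖z‖ ^ 2) : ℝ) : ℂ)) := by
        intro z
        rw [hval, hval, him, him]
        simp [even_of_gram hq]
      have h := integral_neg_eq_self (fun z : E => RCLike.im (Real.fourierChar (-⟪z, ξ⟫) •
          ((q z * Real.exp (-(b / 2) * ‖z‖ ^ 2) : ℝ) : ℂ))) volume
      simp only [hodd, integral_neg] at h
      linarith

/-- **Bochner's theorem**, for a function given as the Gram matrix of a continuous family. -/
theorem exists_kernelOf_eq_of_gram (hw : Continuous w) (hq : ∀ x y, ⟪w x, w y⟫ = q (x - y)) :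
    ∃ ν : Measure E, IsFiniteMeasure ν ∧ ∀ z, kernelOf ν z = q z := by
  -- The passage to probability measures below divides by the total mass `q 0`; if it is zero, then
  -- q = 0.
  rcases (norm_sq_eq_of_gram hq 0 ▸ sq_nonneg _ : 0 ≤ q 0).eq_or_lt with h0 | h0
  · refine ⟨0, inferInstance, fun z => ?_⟩
    have := abs_le_of_gram hq z
    rw [← h0, abs_nonpos_iff] at this
    simp [kernelOf, this]
  have hex : ∀ n : ℕ, ∃ ν : Measure E, IsFiniteMeasure ν ∧ ∀ z, kernelOf ν z =
      ((q z * Real.exp (-((1 / ((n : ℝ) + 1)) / 2) * ‖z‖ ^ 2) : ℝ) : ℂ) := fun n =>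
    exists_kernelOf_eq_mul_gaussian hw hq (by positivity)
  choose μ hμ hμq using hex
  have hmass : ∀ n, μ n Set.univ = ENNReal.ofReal (q 0) := by
    intro n
    have h := hμq n 0
    rw [kernelOf_eq_charFun, smul_zero, charFun_zero, Complex.ofReal_inj] at h
    rw [← ofReal_measureReal, h]
    simp
  have hP : ∀ n, IsProbabilityMeasure ((ENNReal.ofReal (q 0))⁻¹ • μ n) := fun n =>
    ⟨by rw [Measure.smul_apply, hmass, smul_eq_mul, ENNReal.inv_mul_cancel
      (by simpa using h0) ENNReal.ofReal_ne_top]⟩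
  have hsmul : ∀ (c : ℝ≥0∞) (ν : Measure E) (z : E), kernelOf (c • ν) z = c.toReal * kernelOf ν z :=
    fun c ν z => by rw [kernelOf, integral_smul_measure, Complex.real_smul, kernelOf]
  have hlim : ∀ z, Tendsto (fun n => kernelOf ((ENNReal.ofReal (q 0))⁻¹ • μ n) z) atTop
      (𝓝 (((q 0)⁻¹ * q z : ℝ) : ℂ)) := by
    intro z
    simp only [hsmul, hμq, ENNReal.toReal_inv, ENNReal.toReal_ofReal h0.le, ← Complex.ofReal_mul]
    refine (Complex.continuous_ofReal.tendsto _).comp (Tendsto.const_mul _ ?_)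
    have h1 := (((tendsto_one_div_add_atTop_nhds_zero_nat (𝕜 := ℝ)).div_const 2).neg.mul_const
      (‖z‖ ^ 2)).rexp.const_mul (q z)
    simpa using h1
  have hqc := continuous_of_gram hw hq
  obtain ⟨ν, hν, hνq⟩ := exists_kernelOf_eq_of_tendsto (by fun_prop) hlim
  refine ⟨ENNReal.ofReal (q 0) • ν, ⟨?_⟩, fun z => ?_⟩
  · rw [Measure.smul_apply, smul_eq_mul]
    exact ENNReal.mul_lt_top ENNReal.ofReal_lt_top (measure_lt_top _ _)
  · rw [hsmul, hνq, ENNReal.toReal_ofReal h0.le, ← Complex.ofReal_mul,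
      mul_inv_cancel_left₀ h0.ne']

end Bochner

end StationaryKernel

end

noncomputable section

open Filter Topology
open scoped RealInnerProductSpace

namespace StationaryKernel

set_option linter.unusedSectionVars false

variable {E : Type*} [NormedAddCommGroup E] [InnerProductSpace ℝ E] [FiniteDimensional ℝ E]
  [MeasurableSpace E] [BorelSpace E]

/-! ### Signed measures and positive decompositions -/

theorem hasGeneralizedFourier_kernelOf_sub (νp νm : Measure E) [IsFiniteMeasure νp]
    [IsFiniteMeasure νm] :
    HasGeneralizedFourier (fun z => kernelOf νp z - kernelOf νm z)
      fun φ => ∫ w, φ w ∂νp - ∫ w, φ w ∂νm := by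
  have hp := hasGeneralizedFourier_kernelOf νp
  have hm := hasGeneralizedFourier_kernelOf νm
  refine ⟨hp.1.sub hm.1, fun φ hφ => ?_⟩
  simp only [sub_mul]
  rw [integral_sub (hp.1.integrable_mul _) (hm.1.integrable_mul _), hp.2 φ hφ, hm.2 φ hφ]

theorem integral_sub_eq_of_isSplit {μ : SignedRadonMeasure E} {νp νm : Measure E}
    [IsFiniteMeasure νp] [IsFiniteMeasure νm] (h : μ.IsSplit νp νm) {φ : E → ℂ}
    (hφ : Continuous φ) (hφs : HasCompactSupport φ) :
    ∫ w, φ w ∂μ.pos - ∫ w, φ w ∂μ.neg = ∫ w, φ w ∂νp - ∫ w, φ w ∂νm := by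
  have := μ.pos_locallyFinite
  have := μ.neg_locallyFinite
  have hi : ∀ ν : Measure E, IsLocallyFiniteMeasure ν → Integrable φ ν := fun ν _ =>
    hφ.integrable_of_hasCompactSupport hφs
  have e : ∫ w, φ w ∂(μ.pos + νm) = ∫ w, φ w ∂(μ.neg + νp) :=
    congrArg (fun m => ∫ w, φ w ∂m) h
  rw [integral_add_measure (hi _ inferInstance) (hi _ inferInstance),
    integral_add_measure (hi _ inferInstance) (hi _ inferInstance)] at e
  linear_combination e

theorem HasFourierMeasure.eq_kernelOf_sub {k : E → ℝ} (hk : Continuous k)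
    {μ : SignedRadonMeasure E} (hμ : HasFourierMeasure k μ) {νp νm : Measure E}
    [IsFiniteMeasure νp] [IsFiniteMeasure νm] (h : μ.IsSplit νp νm) (z : E) :
    (k z : ℂ) = kernelOf νp z - kernelOf νm z := by
  refine congrFun (eq_of_hasGeneralizedFourier (f := fun z => (k z : ℂ))
    (g := fun z => kernelOf νp z - kernelOf νm z) (by fun_prop)
    ((continuous_kernelOf νp).sub (continuous_kernelOf νm)) ⟨hμ.1, fun φ hφ => ?_⟩
    (hasGeneralizedFourier_kernelOf_sub νp νm)) z
  rw [hμ.2 φ hφ]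
  exact integral_sub_eq_of_isSplit h φ.continuous hφ

theorem hasFourierMeasure_of_eq_kernelOf_sub {k : E → ℝ} {νp νm : Measure E}
    [IsFiniteMeasure νp] [IsFiniteMeasure νm]
    (h : ∀ z, (k z : ℂ) = kernelOf νp z - kernelOf νm z) {μ : SignedRadonMeasure E}
    (hμ : μ.IsSplit νp νm) : HasFourierMeasure k μ := by
  have hf := hasGeneralizedFourier_kernelOf_sub νp νm
  rw [← funext h] at hf
  exact ⟨hf.1, fun φ hφ => (hf.2 φ hφ).trans
    (integral_sub_eq_of_isSplit hμ φ.continuous hφ).symm⟩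

/-- The parts of μ may have infinite mass, so the two differences are first rearranged into sums,
which are locally finite measures determined by test functions. -/
theorem HasFourierMeasure.isSplit {k : E → ℝ} {μ : SignedRadonMeasure E}
    (hμ : HasFourierMeasure k μ) {νp νm : Measure E} [IsFiniteMeasure νp] [IsFiniteMeasure νm]
    (h : ∀ z, (k z : ℂ) = kernelOf νp z - kernelOf νm z) : μ.IsSplit νp νm := by
  have := μ.pos_locallyFinite
  have := μ.neg_locallyFinite
  have := isLocallyFiniteMeasure_add μ.pos νm
  have := isLocallyFiniteMeasure_add μ.neg νp
  have hf := hasGeneralizedFourier_kernelOf_sub νp νm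
  rw [← funext h] at hf
  refine measure_ext_of_integral_contDiff fun u hu hus => ?_
  have h1 : HasCompactSupport (fun x => ((u x : ℝ) : ℂ)) :=
    hus.comp_left (g := fun r : ℝ => (r : ℂ)) (by simp)
  have e : ∫ x, (u x : ℂ) ∂μ.pos - ∫ x, (u x : ℂ) ∂μ.neg =
      ∫ x, (u x : ℂ) ∂νp - ∫ x, (u x : ℂ) ∂νm := (hμ.2 (h1.toSchwartzMap (Complex.ofRealCLM.contDiff.comp hu)) h1).symm.trans
    (hf.2 (h1.toSchwartzMap (Complex.ofRealCLM.contDiff.comp hu)) h1)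
  simp only [integral_complex_ofReal] at e
  norm_cast at e
  have hi : ∀ ν : Measure E, IsLocallyFiniteMeasure ν → Integrable u ν := fun ν _ =>
    hu.continuous.integrable_of_hasCompactSupport hus
  rw [integral_add_measure (hi _ inferInstance) (hi _ inferInstance),
    integral_add_measure (hi _ inferInstance) (hi _ inferInstance)]
  linear_combination e

/-- Minimality of the Jordan decomposition: on the set that carries `μ.pos`, the measure `μ.neg`
vanishes, so `μ.pos ≤ νp` there; likewise `μ.neg ≤ νm` on the complement. -/
theorem SignedRadonMeasure.IsSplit.totalMass_lt_top {μ : SignedRadonMeasure E}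
    {νp νm : Measure E} [IsFiniteMeasure νp] [IsFiniteMeasure νm] (h : μ.IsSplit νp νm) :
    μ.totalMass < ∞ := by
  obtain ⟨S, hS, hpos, hneg⟩ := μ.mutuallySingular
  have h1 : μ.pos Set.univ < ∞ := by
    rw [← measure_add_measure_compl hS, hpos, zero_add]
    calc μ.pos Sᶜ ≤ (μ.pos + νm) Sᶜ := Measure.le_add_right le_rfl _
      _ = νp Sᶜ := by rw [show μ.pos + νm = μ.neg + νp from h, Measure.add_apply, hneg, zero_add]
      _ < ∞ := measure_lt_top _ _
  have h2 : μ.neg Set.univ < ∞ := by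
    rw [← measure_add_measure_compl hS, hneg, add_zero]
    calc μ.neg S ≤ (μ.neg + νp) S := Measure.le_add_right le_rfl _
      _ = νm S := by rw [← show μ.pos + νm = μ.neg + νp from h, Measure.add_apply, hpos, zero_add]
      _ < ∞ := measure_lt_top _ _
  exact ENNReal.add_lt_top.2 ⟨h1, h2⟩

/-- The Jordan decomposition of the difference of two finite measures. -/
theorem exists_isSplit (νp νm : Measure E) [IsFiniteMeasure νp] [IsFiniteMeasure νm] :
    ∃ μ : SignedRadonMeasure E, μ.IsSplit νp νm := by
  set j := (νp.toSignedMeasure - νm.toSignedMeasure).toJordanDecomposition with hj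
  have := j.posPart_finite
  have := j.negPart_finite
  refine ⟨⟨j.posPart, j.negPart, inferInstance, inferInstance, j.mutuallySingular⟩, ?_⟩
  have h : j.posPart.toSignedMeasure - j.negPart.toSignedMeasure =
      νp.toSignedMeasure - νm.toSignedMeasure :=
    SignedMeasure.toSignedMeasure_toJordanDecomposition _
  change j.posPart + νm = j.negPart + νp
  refine Measure.toSignedMeasure_eq_toSignedMeasure_iff.1 ?_
  rw [Measure.toSignedMeasure_add, Measure.toSignedMeasure_add]
  rw [sub_eq_sub_iff_add_eq_add] at h
  rw [h, add_comm]

/-- The real part of the inner product of L²(ν) is a real inner product. Real parts are needed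
because `kernelOf ν` may be complex-valued while the kernels of a positive decomposition are real.
-/
theorem isPositiveDefinite_re_kernelOf (ν : Measure E) [IsFiniteMeasure ν] :
    IsPositiveDefinite fun z => (kernelOf ν z).re := by
  let _ := InnerProductSpace.rclikeToReal ℂ (Lp ℂ 2 ν)
  refine isPositiveDefinite_of_gram (charLp ν) fun x y => ?_
  rw [← inner_charLp_charLp]
  rfl

theorem hasPositiveDecomposition_of_eq_kernelOf_sub {k : E → ℝ} {νp νm : Measure E}
    [IsFiniteMeasure νp] [IsFiniteMeasure νm]
    (h : ∀ z, (k z : ℂ) = kernelOf νp z - kernelOf νm z) : HasPositiveDecomposition k :=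
  ⟨_, _, isPositiveDefinite_re_kernelOf νp, isPositiveDefinite_re_kernelOf νm, fun z => by
    rw [← Complex.sub_re, ← h, Complex.ofReal_re]⟩

theorem HasPositiveDecomposition.exists_eq_kernelOf_sub {k : E → ℝ} (hk : Continuous k)
    (h : HasPositiveDecomposition k) : ∃ νp νm : Measure E, IsFiniteMeasure νp ∧
      IsFiniteMeasure νm ∧ ∀ z, (k z : ℂ) = kernelOf νp z - kernelOf νm z := by
  obtain ⟨V, _, _, _, v₁, v₂, q₁, q₂, h1, h2, hq1, hq2, hkq⟩ := h.exists_continuous_gram hk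
  obtain ⟨νp, hp, hpq⟩ := exists_kernelOf_eq_of_gram h1 hq1
  obtain ⟨νm, hm, hmq⟩ := exists_kernelOf_eq_of_gram h2 hq2
  exact ⟨νp, νm, hp, hm, fun z => by rw [hpq, hmq, hkq, Complex.ofReal_sub]⟩

theorem SignedRadonMeasure.isFiniteMeasure_of_totalMass {μ : SignedRadonMeasure E}
    (h : μ.totalMass < ∞) : IsFiniteMeasure μ.pos ∧ IsFiniteMeasure μ.neg :=
  ⟨⟨(ENNReal.add_lt_top.1 h).1⟩, ⟨(ENNReal.add_lt_top.1 h).2⟩⟩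

theorem HasFourierMeasure.hasPositiveDecomposition {k : E → ℝ} (hk : Continuous k)
    {μ : SignedRadonMeasure E} (hμ : HasFourierMeasure k μ) (h : μ.totalMass < ∞) :
    HasPositiveDecomposition k := by
  obtain ⟨_, _⟩ := SignedRadonMeasure.isFiniteMeasure_of_totalMass h
  exact hasPositiveDecomposition_of_eq_kernelOf_sub
    (hμ.eq_kernelOf_sub hk (show μ.pos + μ.neg = μ.neg + μ.pos from add_comm _ _))

end StationaryKernel

end

/-! ### The main theorem -/

theorem mainTheorem1 {d : ℕ} (k : EuclideanSpace ℝ (Fin d) → ℝ) (hk : Continuous k)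
    (hk_tempered : StationaryKernel.IsTempered fun z => (k z : ℂ)) :
    -- existence, including that the Fourier transform of a decomposable kernel is a measure
    (StationaryKernel.HasPositiveDecomposition k ↔
      ∃ μ : StationaryKernel.SignedRadonMeasure (EuclideanSpace ℝ (Fin d)),
        StationaryKernel.HasFourierMeasure k μ ∧ μ.totalMass < ∞) ∧
    ∀ μ : StationaryKernel.SignedRadonMeasure (EuclideanSpace ℝ (Fin d)),
      StationaryKernel.HasFourierMeasure k μ →
      -- existence, for a kernel whose Fourier transform is the measure `μ`
      (StationaryKernel.HasPositiveDecomposition k ↔ μ.totalMass < ∞) ∧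
      -- representation
      (μ.totalMass < ∞ →
        ∀ μp μm : Measure (EuclideanSpace ℝ (Fin d)), IsFiniteMeasure μp → IsFiniteMeasure μm →
          μ.IsSplit μp μm →
          (∀ z, (k z : ℂ) = StationaryKernel.kernelOf μp z - StationaryKernel.kernelOf μm z) ∧
          ∀ ν : Measure (EuclideanSpace ℝ (Fin d)), ν = μp ∨ ν = μm →
            StationaryKernel.IsPositiveDefinite (StationaryKernel.kernelOf ν) ∧
            ∀ (𝕜 : Type) [RCLike 𝕜] (H : Type*) [NormedAddCommGroup H] [InnerProductSpace 𝕜 H]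
              [CompleteSpace H] [RKHS 𝕜 H (EuclideanSpace ℝ (Fin d)) 𝕜],
              (∀ x y, RCLike.map 𝕜 ℂ (RKHS.kernel H x y (1 : 𝕜)) =
                StationaryKernel.kernelOf ν (x - y)) →
              StationaryKernel.IsSpectralSpace H ν) := by
  refine ⟨⟨fun h => ?_, fun ⟨μ, hμ, hfin⟩ => hμ.hasPositiveDecomposition hk hfin⟩,
    fun μ hμ => ⟨⟨fun h => ?_, hμ.hasPositiveDecomposition hk⟩, ?_⟩⟩
  · obtain ⟨νp, νm, _, _, hν⟩ := h.exists_eq_kernelOf_sub hk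
    obtain ⟨μ, hμ⟩ := StationaryKernel.exists_isSplit νp νm
    exact ⟨μ, StationaryKernel.hasFourierMeasure_of_eq_kernelOf_sub hν hμ, hμ.totalMass_lt_top⟩
  · obtain ⟨νp, νm, _, _, hν⟩ := h.exists_eq_kernelOf_sub hk
    exact (hμ.isSplit hν).totalMass_lt_top
  · intro _ μp μm _ _ hsplit
    refine ⟨hμ.eq_kernelOf_sub hk hsplit, fun ν hν => ?_⟩
    have : IsFiniteMeasure ν := by rcases hν with rfl | rfl <;> infer_instance
    exact ⟨StationaryKernel.isPositiveDefinite_kernelOf ν,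
      fun 𝕜 _ H _ _ _ _ hH => StationaryKernel.isSpectralSpace_of_kernel H hH⟩
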